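/- Throughout, bicategories, pseudofunctors, pseudonatural transformations and modifications are the usual (weak) ones; $\mathcal B^{\mathcal A}$ is the bicategory of pseudofunctors $\mathcal A\to\mathcal B$, pseudonatural transformations and modifications. For a pseudonatural transformation (or modification) $\Psi$, $\Psi_P$ is pre-whiskering by a pseudofunctor $P$ and $G(\Psi)$ (or $G\Psi$) is post-whiskering by $G$. Unnamed arrows $\cong$ are the canonical associators; the unitors needed when $\Psi$ starts or ends at an identity pseudofunctor are included in $\Psi_P$ and $G(\Psi)$. A biadjunction $L\dashv R$ consists of pseudofunctors $L,R$, pseudonatural transformations $\mathrm{Id}\Rightarrow RL$ (unit) and $LR\Rightarrow\mathrm{Id}$ (counit), and two invertible modifications filling the triangles (no swallowtail equations required). In a bicategory, let $\varphi\colon f\Rightarrow g$ be a 2-morphism with $f,g\colon x\to y$. A co-inverter of $\varphi$ is a pair $(z,p\colon y\to z)$ such that $p*\varphi$ is invertible and, for every object $w$, $h\mapsto h\circ p$ is an equivalence from $\mathrm{Hom}(z,w)$ to the full subcategory of $\mathrm{Hom}(y,w)$ on those $k$ for which $k*\varphi$ is invertible. A 1-morphism $p\colon x\to y$ is co-fully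 faithful if for every object $w$ the functor $-\circ p\colon\mathrm{Hom}(y,w)\to\mathrm{Hom}(x,w)$ is fully faithful. **Theorem.** Let $F\colon\mathcal A\to\mathcal B$, $R\colon\mathcal B\to\mathcal A$, $H\colon\mathcal A\to\mathcal C$, $T\colon\mathcal C\to\mathcal A$, $G\colon\mathcal B\to\mathcal C$ be pseudofunctors between bicategories, with biadjunctions $F\dashv R$ and $H\dashv T$, and let $\Gamma\colon GF\Rightarrow H$ be a pseudonatural equivalence, with a chosen quasi-inverse $\Gamma^{-1}$ making an adjoint equivalence. Let $\mathrm X\colon FR\Rightarrow\mathrm{Id}_{\mathcal B}$ be the counit of $F\dashv R$, and $\Psi\colon\mathrm{Id}_{\mathcal A}\Rightarrow TH$, $\Upsilon\colon HT\Rightarrow\mathrm{Id}_{\mathcal C}$ the unit and counit of $H\dashv T$. Set $$\Psi'\colon \mathrm{Id}_{\mathcal A}\xRightarrow{\Psi}TH\xRightarrow{T\Gamma^{-1}}T(GF),\qquad \Upsilon'\colon (GF)T\xRightarrow{\Gamma_T}HT\xRightarrow{\Upsilon}\mathrm{Id}_{\mathcal C},$$ $$\mathrm X'\colon (GF)R\cong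 G(FR)\xRightarrow{G\mathrm X}G,\qquad \Upsilon''\colon G(FT)\cong(GF)T\xRightarrow{\Upsilon'}\mathrm{Id}_{\mathcal C},$$ $$\Delta\colon R\xRightarrow{\Psi'_R}(T(GF))R\cong T((GF)R)\xRightarrow{T\mathrm X'}TG,\qquad \Delta'\colon FR\xRightarrow{F\Delta}F(TG)\cong(FT)G,$$ $$\Delta''\colon (FR)(FR)\xRightarrow{(FR)\Delta'}(FR)((FT)G)\cong((FR)(FT))G,$$ $$\mathrm K'\colon ((FT)G)(FT)\cong(FT)(G(FT))\xRightarrow{(FT)\Upsilon''}FT,\qquad \mathrm K=\mathrm K'\circ\Delta'_{FT}\colon (FR)(FT)\Rightarrow FT.$$ Let $\varphi_1\colon(\mathrm X_{FT})_G\circ\Delta''\cong\Delta'\circ\mathrm X_{FR}$ be the invertible modification $(\mathrm X_{FT})_G\circ\Delta''\cong\mathrm X_{(FT)G}\circ(FR)\Delta'\cong\Delta'\circ\mathrm X_{FR}$ given by associativity of whiskering and by the pseudonaturality (exchange) modification of $\mathrm X$ along $\Delta'$. Let $\varphi_2\colon\mathrm K_G\circ\Delta''\cong\Delta'\circ FR(\mathrm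 X)$ be the invertible modification $$\mathrm K_G\circ\Delta''\cong \mathrm K'_G\circ\Delta'_{(FT)G}\circ(FR)\Delta'\cong \mathrm K'_G\circ((FT)G)\Delta'\circ\Delta'_{FR}\cong ((FT)G)\mathrm X\circ\Delta'_{FR}\cong\Delta'\circ FR(\mathrm X)$$ (associators omitted), where the second and fourth isomorphisms are the exchange modifications of $\Delta'$ along $\Delta'$ and along $\mathrm X$, and the third comes from $\mathrm K'_G\circ((FT)G)\Delta'\cong FT(\Upsilon''_G\circ G\Delta')$ and $FT$ applied to the composite $$\Upsilon''_G\circ G\Delta'\cong\Upsilon'_G\circ(GF)T\mathrm X'\circ(GF)\Psi'_R\cong\mathrm X'\circ\Upsilon'_{(GF)R}\circ(GF)\Psi'_R\cong\mathrm X'\cong G\mathrm X ,$$ given by the exchange modification of $\Upsilon'$ along $\mathrm X'$ and by the triangle modification $\Upsilon'_{GF}\circ(GF)\Psi'\cong\mathrm{Id}_{GF}$ obtained by transport along $\Gamma$ from the one $\Upsilon_H\circ H\Psi\cong\mathrm{Id}_H$ of $H\dashv T$. Assume: 1. there is a modification $\xi\colon\mathrm X_{FT}\Rrightarrow\mathrm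 K$ with a co-inverter $(S,\Pi\colon FT\Rightarrow S)$ in $\mathcal B^{\mathcal C}$; 2. $G$ preserves it: $(GS,G(\Pi))$ is a co-inverter of $G(\xi)$ in $\mathcal C^{\mathcal C}$; 3. $\Upsilon''*G(\xi)$ is invertible; 4. $(\mathrm{Id}_{\mathcal B},\mathrm X)$ is a co-inverter in $\mathcal B^{\mathcal B}$ of a modification $\pi\colon\mathrm X_{FR}\Rrightarrow FR(\mathrm X)$ such that $\varphi_2\circ(\xi_G*\Delta'')=(\Delta'*\pi)\circ\varphi_1$; 5. $G(\mathrm X)$ is co-fully faithful in $\mathcal C^{\mathcal B}$; 6. $\mathrm X_{FT}$ is co-fully faithful in $\mathcal B^{\mathcal C}$. Then $S$ is a right biadjoint of $G$, i.e. there is a biadjunction $G\dashv S$. -/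

import Mathlib

open CategoryTheory Bicategory
open scoped Pseudofunctor.StrongTrans

universe wA vA uA wB vB uB wC vC uC wD vD uD wE vE uE

namespace Bicat

section Whiskering

variable {A : Type uA} [Bicategory.{wA, vA} A] {B : Type uB} [Bicategory.{wB, vB} B]
  {C : Type uC} [Bicategory.{wC, vC} C] {D : Type uD} [Bicategory.{wD, vD} D]

/-- Pre-whiskering `θ_P`. Here and below `P.comp G` is the composite usually written `G P`, and
`θ ≫ θ'` the one usually written `θ' ∘ θ`. -/
def preW (P : A ⥤ᵖ B) {G₁ G₂ : B ⥤ᵖ C} (θ : G₁ ⟶ G₂) : P.comp G₁ ⟶ P.comp G₂ where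
  app a := θ.app (P.obj a)
  naturality f := θ.naturality (P.map f)
  naturality_naturality η := θ.naturality_naturality (P.map₂ η)
  naturality_id a := by
    have key : (θ.naturality (P.map (𝟙 a))).hom ≫
        θ.app (P.obj a) ◁ (G₂.map₂ (P.mapId a).hom ≫ (G₂.mapId (P.obj a)).hom) =
        (G₁.map₂ (P.mapId a).hom ≫ (G₁.mapId (P.obj a)).hom) ▷ θ.app (P.obj a) ≫
          (λ_ (θ.app (P.obj a))).hom ≫ (ρ_ (θ.app (P.obj a))).inv := by
      rw [Bicategory.whiskerLeft_comp, ← θ.naturality_naturality_assoc, θ.naturality_id,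
        Bicategory.comp_whiskerRight, Category.assoc]
    exact key
  naturality_comp {a b c} f g := by
    have key : (θ.naturality (P.map (f ≫ g))).hom ≫
        θ.app (P.obj a) ◁ (G₂.map₂ (P.mapComp f g).hom ≫ (G₂.mapComp _ _).hom) =
        (G₁.map₂ (P.mapComp f g).hom ≫ (G₁.mapComp _ _).hom) ▷ θ.app (P.obj c) ≫
          (α_ _ _ _).hom ≫ G₁.map (P.map f) ◁ (θ.naturality (P.map g)).hom ≫
          (α_ _ _ _).inv ≫ (θ.naturality (P.map f)).hom ▷ G₂.map (P.map g) ≫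
          (α_ _ _ _).hom := by
      rw [Bicategory.whiskerLeft_comp, ← θ.naturality_naturality_assoc, θ.naturality_comp,
        Bicategory.comp_whiskerRight, Category.assoc]
    exact key

theorem map₂_associator_inv (G : B ⥤ᵖ C) {a b c d : B} (f : a ⟶ b) (g : b ⟶ c) (h : c ⟶ d) :
    G.map₂ (α_ f g h).inv = (G.mapComp f (g ≫ h)).hom ≫ G.map f ◁ (G.mapComp g h).hom ≫
      (α_ (G.map f) (G.map g) (G.map h)).inv ≫ (G.mapComp f g).inv ▷ G.map h ≫
      (G.mapComp (f ≫ g) h).inv := by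
  rw [← cancel_epi (G.map₂ (α_ f g h).hom), ← G.map₂_comp, Iso.hom_inv_id, G.map₂_id,
    G.map₂_associator]
  simp only [Category.assoc, Iso.inv_hom_id_assoc, whiskerLeft_inv_hom_assoc, Iso.hom_inv_id_assoc,
    hom_inv_whiskerRight_assoc, Iso.hom_inv_id]

theorem map₂_rightUnitor_inv (G : B ⥤ᵖ C) {a b : B} (f : a ⟶ b) :
    G.map₂ (ρ_ f).inv = (ρ_ (G.map f)).inv ≫ G.map f ◁ (G.mapId b).inv ≫
      (G.mapComp f (𝟙 b)).inv := by
  rw [← cancel_epi (G.map₂ (ρ_ f).hom), ← G.map₂_comp, Iso.hom_inv_id, G.map₂_id,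
    G.map₂_right_unitor]
  simp only [Category.assoc, Iso.hom_inv_id_assoc, whiskerLeft_hom_inv_assoc, Iso.hom_inv_id]

theorem map₂_leftUnitor_inv (G : B ⥤ᵖ C) {a b : B} (f : a ⟶ b) :
    G.map₂ (λ_ f).inv = (λ_ (G.map f)).inv ≫ (G.mapId a).inv ▷ G.map f ≫
      (G.mapComp (𝟙 a) f).inv := by
  rw [← cancel_epi (G.map₂ (λ_ f).hom), ← G.map₂_comp, Iso.hom_inv_id, G.map₂_id,
    G.map₂_left_unitor]
  simp only [Category.assoc, Iso.hom_inv_id_assoc, hom_inv_whiskerRight_assoc, Iso.hom_inv_id]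

/-- Post-whiskering `G(η)`. -/
def postW {F₁ F₂ : A ⥤ᵖ B} (η : F₁ ⟶ F₂) (G : B ⥤ᵖ C) : F₁.comp G ⟶ F₂.comp G where
  app a := G.map (η.app a)
  naturality f := (G.mapComp _ _).symm ≪≫ G.map₂Iso (η.naturality f) ≪≫ G.mapComp _ _
  naturality_naturality {a b f g} θ := by
    have key : G.map₂ (F₁.map₂ θ) ▷ G.map (η.app b) ≫
          (G.mapComp (F₁.map g) (η.app b)).inv ≫ G.map₂ (η.naturality g).hom ≫
            (G.mapComp (η.app a) (F₂.map g)).hom =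
        ((G.mapComp (F₁.map f) (η.app b)).inv ≫ G.map₂ (η.naturality f).hom ≫
          (G.mapComp (η.app a) (F₂.map f)).hom) ≫ G.map (η.app a) ◁ G.map₂ (F₂.map₂ θ) := by
      have h := congrArg (fun t => (G.mapComp _ _).inv ≫ G.map₂ t ≫ (G.mapComp _ _).hom)
        (η.naturality_naturality θ)
      simpa [-Pseudofunctor.StrongTrans.naturality_naturality] using h
    exact key
  naturality_id a := by
    have key : ((G.mapComp _ _).inv ≫ G.map₂ (η.naturality (𝟙 a)).hom ≫ (G.mapComp _ _).hom) ≫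
          G.map (η.app a) ◁ (G.map₂ (F₂.mapId a).hom ≫ (G.mapId (F₂.obj a)).hom) =
        (G.map₂ (F₁.mapId a).hom ≫ (G.mapId (F₁.obj a)).hom) ▷ G.map (η.app a) ≫
          (λ_ (G.map (η.app a))).hom ≫ (ρ_ (G.map (η.app a))).inv := by
      have h := congrArg (fun t => (G.mapComp _ _).inv ≫ G.map₂ t ≫ (G.mapComp _ _).hom ≫
        _ ◁ (G.mapId (F₂.obj a)).hom) (η.naturality_id a)
      simpa [map₂_rightUnitor_inv, -Pseudofunctor.StrongTrans.naturality_id] using h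
    exact key
  naturality_comp {a b c} f g := by
    have key : ((G.mapComp _ _).inv ≫ G.map₂ (η.naturality (f ≫ g)).hom ≫ (G.mapComp _ _).hom) ≫
          G.map (η.app a) ◁ (G.map₂ (F₂.mapComp f g).hom ≫ (G.mapComp _ _).hom) =
        (G.map₂ (F₁.mapComp f g).hom ≫ (G.mapComp _ _).hom) ▷ G.map (η.app c) ≫
          (α_ _ _ _).hom ≫ G.map (F₁.map f) ◁ ((G.mapComp _ _).inv ≫
            G.map₂ (η.naturality g).hom ≫ (G.mapComp _ _).hom) ≫ (α_ _ _ _).inv ≫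
          ((G.mapComp _ _).inv ≫ G.map₂ (η.naturality f).hom ≫ (G.mapComp _ _).hom) ▷
            G.map (F₂.map g) ≫ (α_ _ _ _).hom := by
      have h := congrArg (fun t => (G.mapComp _ _).inv ≫ G.map₂ t ≫ (G.mapComp _ _).hom ≫
        _ ◁ (G.mapComp _ _).hom) (η.naturality_comp f g)
      simpa [map₂_associator_inv, -Pseudofunctor.StrongTrans.naturality_comp] using h
    exact key

/-- Pre-whiskering of a modification. -/
def preW₂ (P : A ⥤ᵖ B) {G₁ G₂ : B ⥤ᵖ C} {θ θ' : G₁ ⟶ G₂} (m : θ ⟶ θ') :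
    preW P θ ⟶ preW P θ' :=
  ⟨{ app := fun a => m.as.app (P.obj a)
     naturality := fun f => m.as.naturality (P.map f) }⟩

/-- Post-whiskering of a modification. -/
def postW₂ {F₁ F₂ : A ⥤ᵖ B} {η η' : F₁ ⟶ F₂} (m : η ⟶ η') (G : B ⥤ᵖ C) :
    postW η G ⟶ postW η' G :=
  ⟨{ app := fun a => G.map₂ (m.as.app a)
     naturality := fun {a b} f => by
      have key : G.map (F₁.map f) ◁ G.map₂ (m.as.app b) ≫
            (G.mapComp _ _).inv ≫ G.map₂ (η'.naturality f).hom ≫ (G.mapComp _ _).hom =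
          ((G.mapComp _ _).inv ≫ G.map₂ (η.naturality f).hom ≫ (G.mapComp _ _).hom) ≫
            G.map₂ (m.as.app a) ▷ G.map (F₂.map f) := by
        have h := congrArg (fun t => (G.mapComp _ _).inv ≫ G.map₂ t ≫ (G.mapComp _ _).hom)
          (m.as.naturality f)
        simpa [-Pseudofunctor.StrongTrans.Modification.naturality] using h
      exact key }⟩

/-- Pre-whiskering of an invertible modification. -/
def preWIso (P : A ⥤ᵖ B) {G₁ G₂ : B ⥤ᵖ C} {θ θ' : G₁ ⟶ G₂} (m : θ ≅ θ') :
    preW P θ ≅ preW P θ' where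
  hom := preW₂ P m.hom
  inv := preW₂ P m.inv
  hom_inv_id := by
    ext a
    exact congrArg (fun t => t.as.app (P.obj a)) m.hom_inv_id
  inv_hom_id := by
    ext a
    exact congrArg (fun t => t.as.app (P.obj a)) m.inv_hom_id

/-- Post-whiskering of an invertible modification. -/
def postWIso {F₁ F₂ : A ⥤ᵖ B} {η η' : F₁ ⟶ F₂} (m : η ≅ η') (G : B ⥤ᵖ C) :
    postW η G ≅ postW η' G where
  hom := postW₂ m.hom G
  inv := postW₂ m.inv G
  hom_inv_id := by
    ext a
    exact (G.map₂_comp _ _).symm.trans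
      ((congrArg (fun t => G.map₂ (t.as.app a)) m.hom_inv_id).trans (G.map₂_id _))
  inv_hom_id := by
    ext a
    exact (G.map₂_comp _ _).symm.trans
      ((congrArg (fun t => G.map₂ (t.as.app a)) m.inv_hom_id).trans (G.map₂_id _))

/-- The associator of the composition of pseudofunctors; its components are identities. -/
def asc (F : A ⥤ᵖ B) (G : B ⥤ᵖ C) (H : C ⥤ᵖ D) :
    F.comp (G.comp H) ⟶ (F.comp G).comp H where
  app a := 𝟙 (H.obj (G.obj (F.obj a)))
  naturality f := ρ_ (H.map (G.map (F.map f))) ≪≫ (λ_ _).symm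
  naturality_naturality {a b f g} η := by
    have key : H.map₂ (G.map₂ (F.map₂ η)) ▷ 𝟙 (H.obj (G.obj (F.obj b))) ≫
          (ρ_ (H.map (G.map (F.map g)))).hom ≫ (λ_ _).inv =
        ((ρ_ (H.map (G.map (F.map f)))).hom ≫ (λ_ _).inv) ≫
          𝟙 (H.obj (G.obj (F.obj a))) ◁ H.map₂ (G.map₂ (F.map₂ η)) := by simp
    exact key
  naturality_id a := by
    have key : ((ρ_ (H.map (G.map (F.map (𝟙 a))))).hom ≫ (λ_ _).inv) ≫
          𝟙 (H.obj (G.obj (F.obj a))) ◁ (H.map₂ (G.map₂ (F.mapId a).hom ≫ (G.mapId _).hom) ≫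
            (H.mapId _).hom) =
        (H.map₂ (G.map₂ (F.mapId a).hom) ≫ H.map₂ (G.mapId _).hom ≫ (H.mapId _).hom) ▷ 𝟙 _ ≫
          (λ_ _).hom ≫ (ρ_ _).inv := by simp
    exact key
  naturality_comp {a b c} f g := by
    have key : ((ρ_ (H.map (G.map (F.map (f ≫ g))))).hom ≫ (λ_ _).inv) ≫
          𝟙 (H.obj (G.obj (F.obj a))) ◁ (H.map₂ (G.map₂ (F.mapComp f g).hom ≫ (G.mapComp _ _).hom) ≫
            (H.mapComp _ _).hom) =
        (H.map₂ (G.map₂ (F.mapComp f g).hom) ≫ H.map₂ (G.mapComp _ _).hom ≫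
            (H.mapComp _ _).hom) ▷ 𝟙 _ ≫
          (α_ _ _ _).hom ≫ H.map (G.map (F.map f)) ◁
            ((ρ_ (H.map (G.map (F.map g)))).hom ≫ (λ_ _).inv) ≫ (α_ _ _ _).inv ≫
          ((ρ_ (H.map (G.map (F.map f)))).hom ≫ (λ_ _).inv) ▷ H.map (G.map (F.map g)) ≫
            (α_ _ _ _).hom := by simp
    exact key

/-- The canonical quasi-inverse of `asc`. -/
def ascInv (F : A ⥤ᵖ B) (G : B ⥤ᵖ C) (H : C ⥤ᵖ D) :
    (F.comp G).comp H ⟶ F.comp (G.comp H) where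
  app a := 𝟙 (H.obj (G.obj (F.obj a)))
  naturality f := ρ_ (H.map (G.map (F.map f))) ≪≫ (λ_ _).symm
  naturality_naturality {a b f g} η := (asc F G H).naturality_naturality η
  naturality_id a := by
    have key : ((ρ_ (H.map (G.map (F.map (𝟙 a))))).hom ≫ (λ_ _).inv) ≫
          𝟙 (H.obj (G.obj (F.obj a))) ◁ (H.map₂ (G.map₂ (F.mapId a).hom) ≫
            H.map₂ (G.mapId _).hom ≫ (H.mapId _).hom) =
        (H.map₂ (G.map₂ (F.mapId a).hom ≫ (G.mapId _).hom) ≫ (H.mapId _).hom) ▷ 𝟙 _ ≫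
          (λ_ _).hom ≫ (ρ_ _).inv := by simp
    exact key
  naturality_comp {a b c} f g := by
    have key : ((ρ_ (H.map (G.map (F.map (f ≫ g))))).hom ≫ (λ_ _).inv) ≫
          𝟙 (H.obj (G.obj (F.obj a))) ◁ (H.map₂ (G.map₂ (F.mapComp f g).hom) ≫
            H.map₂ (G.mapComp _ _).hom ≫ (H.mapComp _ _).hom) =
        (H.map₂ (G.map₂ (F.mapComp f g).hom ≫ (G.mapComp _ _).hom) ≫
            (H.mapComp _ _).hom) ▷ 𝟙 _ ≫
          (α_ _ _ _).hom ≫ H.map (G.map (F.map f)) ◁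
            ((ρ_ (H.map (G.map (F.map g)))).hom ≫ (λ_ _).inv) ≫ (α_ _ _ _).inv ≫
          ((ρ_ (H.map (G.map (F.map f)))).hom ≫ (λ_ _).inv) ▷ H.map (G.map (F.map g)) ≫
            (α_ _ _ _).hom := by simp
    exact key

/-- The right unitor `P Id ⟶ P`; its components are identities. -/
def runit (P : A ⥤ᵖ B) : P.comp (Pseudofunctor.id B) ⟶ P where
  app a := 𝟙 (P.obj a)
  naturality f := ρ_ (P.map f) ≪≫ (λ_ _).symm
  naturality_naturality {a b f g} η := by
    have key : P.map₂ η ▷ 𝟙 (P.obj b) ≫ (ρ_ (P.map g)).hom ≫ (λ_ _).inv =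
        ((ρ_ (P.map f)).hom ≫ (λ_ _).inv) ≫ 𝟙 (P.obj a) ◁ P.map₂ η := by simp
    exact key
  naturality_id a := by
    have key : ((ρ_ (P.map (𝟙 a))).hom ≫ (λ_ _).inv) ≫ 𝟙 (P.obj a) ◁ (P.mapId a).hom =
        ((P.mapId a).hom ≫ 𝟙 _) ▷ 𝟙 _ ≫ (λ_ _).hom ≫ (ρ_ _).inv := by simp
    exact key
  naturality_comp {a b c} f g := by
    have key : ((ρ_ (P.map (f ≫ g))).hom ≫ (λ_ _).inv) ≫ 𝟙 (P.obj a) ◁ (P.mapComp f g).hom =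
        ((P.mapComp f g).hom ≫ 𝟙 _) ▷ 𝟙 _ ≫ (α_ _ _ _).hom ≫
          P.map f ◁ ((ρ_ (P.map g)).hom ≫ (λ_ _).inv) ≫ (α_ _ _ _).inv ≫
          ((ρ_ (P.map f)).hom ≫ (λ_ _).inv) ▷ P.map g ≫ (α_ _ _ _).hom := by simp
    exact key

/-- The canonical quasi-inverse of `runit`. -/
def runitInv (P : A ⥤ᵖ B) : P ⟶ P.comp (Pseudofunctor.id B) where
  app a := 𝟙 (P.obj a)
  naturality f := ρ_ (P.map f) ≪≫ (λ_ _).symm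
  naturality_naturality {a b f g} η := (runit P).naturality_naturality η
  naturality_id a := by
    have key : ((ρ_ (P.map (𝟙 a))).hom ≫ (λ_ _).inv) ≫
          𝟙 (P.obj a) ◁ ((P.mapId a).hom ≫ 𝟙 _) =
        (P.mapId a).hom ▷ 𝟙 _ ≫ (λ_ _).hom ≫ (ρ_ _).inv := by simp
    exact key
  naturality_comp {a b c} f g := by
    have key : ((ρ_ (P.map (f ≫ g))).hom ≫ (λ_ _).inv) ≫
          𝟙 (P.obj a) ◁ ((P.mapComp f g).hom ≫ 𝟙 _) =
        (P.mapComp f g).hom ▷ 𝟙 _ ≫ (α_ _ _ _).hom ≫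
          P.map f ◁ ((ρ_ (P.map g)).hom ≫ (λ_ _).inv) ≫ (α_ _ _ _).inv ≫
          ((ρ_ (P.map f)).hom ≫ (λ_ _).inv) ▷ P.map g ≫ (α_ _ _ _).hom := by simp
    exact key

/-- The left unitor `Id P ⟶ P`; its components are identities. -/
def lunit (P : A ⥤ᵖ B) : (Pseudofunctor.id A).comp P ⟶ P where
  app a := 𝟙 (P.obj a)
  naturality f := ρ_ (P.map f) ≪≫ (λ_ _).symm
  naturality_naturality {a b f g} η := (runit P).naturality_naturality η
  naturality_id a := by
    have key : ((ρ_ (P.map (𝟙 a))).hom ≫ (λ_ _).inv) ≫ 𝟙 (P.obj a) ◁ (P.mapId a).hom =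
        (P.map₂ (𝟙 _) ≫ (P.mapId a).hom) ▷ 𝟙 _ ≫ (λ_ _).hom ≫ (ρ_ _).inv := by simp
    exact key
  naturality_comp {a b c} f g := by
    have key : ((ρ_ (P.map (f ≫ g))).hom ≫ (λ_ _).inv) ≫ 𝟙 (P.obj a) ◁ (P.mapComp f g).hom =
        (P.map₂ (𝟙 _) ≫ (P.mapComp f g).hom) ▷ 𝟙 _ ≫ (α_ _ _ _).hom ≫
          P.map f ◁ ((ρ_ (P.map g)).hom ≫ (λ_ _).inv) ≫ (α_ _ _ _).inv ≫
          ((ρ_ (P.map f)).hom ≫ (λ_ _).inv) ▷ P.map g ≫ (α_ _ _ _).hom := by simp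
    exact key

/-- The canonical quasi-inverse of `lunit`. -/
def lunitInv (P : A ⥤ᵖ B) : P ⟶ (Pseudofunctor.id A).comp P where
  app a := 𝟙 (P.obj a)
  naturality f := ρ_ (P.map f) ≪≫ (λ_ _).symm
  naturality_naturality {a b f g} η := (runit P).naturality_naturality η
  naturality_id a := by
    have key : ((ρ_ (P.map (𝟙 a))).hom ≫ (λ_ _).inv) ≫
          𝟙 (P.obj a) ◁ (P.map₂ (𝟙 _) ≫ (P.mapId a).hom) =
        (P.mapId a).hom ▷ 𝟙 _ ≫ (λ_ _).hom ≫ (ρ_ _).inv := by simp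
    exact key
  naturality_comp {a b c} f g := by
    have key : ((ρ_ (P.map (f ≫ g))).hom ≫ (λ_ _).inv) ≫
          𝟙 (P.obj a) ◁ (P.map₂ (𝟙 _) ≫ (P.mapComp f g).hom) =
        (P.mapComp f g).hom ▷ 𝟙 _ ≫ (α_ _ _ _).hom ≫
          P.map f ◁ ((ρ_ (P.map g)).hom ≫ (λ_ _).inv) ≫ (α_ _ _ _).inv ≫
          ((ρ_ (P.map f)).hom ≫ (λ_ _).inv) ▷ P.map g ≫ (α_ _ _ _).hom := by simp
    exact key

/-- Pre-whiskering preserves composition. -/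
def preWComp (P : A ⥤ᵖ B) {G₁ G₂ G₃ : B ⥤ᵖ C} (θ : G₁ ⟶ G₂) (θ' : G₂ ⟶ G₃) :
    preW P (θ ≫ θ') ≅ preW P θ ≫ preW P θ' :=
  Iso.refl (preW P θ ≫ preW P θ')

/-- Pre-whiskering preserves identities. -/
def preWId (P : A ⥤ᵖ B) (G : B ⥤ᵖ C) : preW P (𝟙 G) ≅ 𝟙 (P.comp G) :=
  Iso.refl (𝟙 (P.comp G))

/-- Post-whiskering preserves composition. -/
def postWComp {F₁ F₂ F₃ : A ⥤ᵖ B} (η : F₁ ⟶ F₂) (η' : F₂ ⟶ F₃) (G : B ⥤ᵖ C) :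
    postW (η ≫ η') G ≅ postW η G ≫ postW η' G :=
  Pseudofunctor.StrongTrans.isoMk (fun a => G.mapComp (η.app a) (η'.app a)) (fun {a b} f => by
    have key : G.map (F₁.map f) ◁ (G.mapComp (η.app b) (η'.app b)).hom ≫
          (α_ _ _ _).inv ≫
          ((G.mapComp _ _).inv ≫ G.map₂ (η.naturality f).hom ≫ (G.mapComp _ _).hom) ▷
            G.map (η'.app b) ≫ (α_ _ _ _).hom ≫
          G.map (η.app a) ◁ ((G.mapComp _ _).inv ≫ G.map₂ (η'.naturality f).hom ≫
            (G.mapComp _ _).hom) ≫ (α_ _ _ _).inv =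
        ((G.mapComp _ _).inv ≫ G.map₂ ((α_ _ _ _).inv ≫ (η.naturality f).hom ▷ η'.app b ≫
          (α_ _ _ _).hom ≫ η.app a ◁ (η'.naturality f).hom ≫ (α_ _ _ _).inv) ≫
            (G.mapComp _ _).hom) ≫
          (G.mapComp (η.app a) (η'.app a)).hom ▷ G.map (F₃.map f) := by
      simp [map₂_associator_inv]
    exact key)

/-- The exchange of post-whiskering and pre-whiskering. -/
def exch {F₁ F₂ : A ⥤ᵖ B} (η : F₁ ⟶ F₂) {G₁ G₂ : B ⥤ᵖ C} (θ : G₁ ⟶ G₂) :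
    postW η G₁ ≫ preW F₂ θ ≅ preW F₁ θ ≫ postW η G₂ :=
  Pseudofunctor.StrongTrans.isoMk (fun a => θ.naturality (η.app a)) (fun {a b} f => by
    have key : G₁.map (F₁.map f) ◁ (θ.naturality (η.app b)).hom ≫
          (α_ _ _ _).inv ≫ (θ.naturality (F₁.map f)).hom ▷ G₂.map (η.app b) ≫ (α_ _ _ _).hom ≫
          θ.app _ ◁ ((G₂.mapComp _ _).inv ≫ G₂.map₂ (η.naturality f).hom ≫
            (G₂.mapComp _ _).hom) ≫ (α_ _ _ _).inv =
        ((α_ _ _ _).inv ≫ ((G₁.mapComp _ _).inv ≫ G₁.map₂ (η.naturality f).hom ≫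
            (G₁.mapComp _ _).hom) ▷ θ.app _ ≫ (α_ _ _ _).hom ≫
          G₁.map (η.app a) ◁ (θ.naturality (F₂.map f)).hom ≫ (α_ _ _ _).inv) ≫
          (θ.naturality (η.app a)).hom ▷ G₂.map (F₂.map f) := by
      have h1 := θ.naturality_comp_hom (F₁.map f) (η.app b)
      have h2 := θ.naturality_comp_hom (η.app a) (F₂.map f)
      have h3 := θ.naturality_naturality (η.naturality f).hom
      rw [h1, h2] at h3
      have h4 := congrArg (fun t => (α_ _ _ _).inv ≫ (G₁.mapComp _ _).inv ▷ _ ≫ t ≫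
        _ ◁ (G₂.mapComp _ _).hom ≫ (α_ _ _ _).inv) h3
      simpa using h4.symm
    exact key)

/-- `asc` and `ascInv` are quasi-inverse. -/
def ascInvAsc (F : A ⥤ᵖ B) (G : B ⥤ᵖ C) (H : C ⥤ᵖ D) :
    ascInv F G H ≫ asc F G H ≅ 𝟙 ((F.comp G).comp H) :=
  Pseudofunctor.StrongTrans.isoMk (fun a => λ_ (𝟙 (H.obj (G.obj (F.obj a)))))
    (fun {a b} f => by
      have key : H.map (G.map (F.map f)) ◁ (λ_ (𝟙 (H.obj (G.obj (F.obj b))))).hom ≫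
          (ρ_ _).hom ≫ (λ_ _).inv =
          ((α_ _ _ _).inv ≫ ((ρ_ (H.map (G.map (F.map f)))).hom ≫ (λ_ _).inv) ▷ _ ≫
            (α_ _ _ _).hom ≫ _ ◁ ((ρ_ (H.map (G.map (F.map f)))).hom ≫ (λ_ _).inv) ≫
            (α_ _ _ _).inv) ≫ (λ_ (𝟙 (H.obj (G.obj (F.obj a))))).hom ▷ _ := by
        bicategory
      exact key)

def ascAscInv (F : A ⥤ᵖ B) (G : B ⥤ᵖ C) (H : C ⥤ᵖ D) :
    asc F G H ≫ ascInv F G H ≅ 𝟙 (F.comp (G.comp H)) :=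
  Pseudofunctor.StrongTrans.isoMk (fun a => λ_ (𝟙 (H.obj (G.obj (F.obj a)))))
    (fun f => (ascInvAsc F G H).hom.as.naturality f)

theorem shift_aux {a b c d : D} {f : a ⟶ b} {u' : b ⟶ d} {u : a ⟶ c} {g : c ⟶ d}
    (N N' : f ≫ u' ⟶ u ≫ g) (h : N = N') :
    f ◁ ((ρ_ u').hom ≫ (λ_ u').inv) ≫ (α_ _ _ _).inv ≫ ((ρ_ f).hom ≫ (λ_ f).inv) ▷ u' ≫
        (α_ _ _ _).hom ≫ 𝟙 a ◁ N ≫ (α_ _ _ _).inv =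
      ((α_ _ _ _).inv ≫ N' ▷ 𝟙 d ≫ (α_ _ _ _).hom ≫ u ◁ ((ρ_ g).hom ≫ (λ_ g).inv) ≫
        (α_ _ _ _).inv) ≫ ((ρ_ u).hom ≫ (λ_ u).inv) ▷ g := by
  subst h
  simp

/-- Naturality of the associator in its first argument. -/
def ascFirst {F₁ F₂ : A ⥤ᵖ B} (η : F₁ ⟶ F₂) (G : B ⥤ᵖ C) (H : C ⥤ᵖ D) :
    postW η (G.comp H) ≫ asc F₂ G H ≅ asc F₁ G H ≫ postW (postW η G) H :=
  Pseudofunctor.StrongTrans.isoMk (fun a => ρ_ (H.map (G.map (η.app a))) ≪≫ (λ_ _).symm)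
    (fun {a b} f => by
      have h : (H.mapComp _ _).inv ≫ H.map₂ ((G.mapComp _ _).inv ≫
            G.map₂ (η.naturality f).hom ≫ (G.mapComp _ _).hom) ≫ (H.mapComp _ _).hom =
          ((H.mapComp _ _).inv ≫ H.map₂ (G.mapComp _ _).inv) ≫
            H.map₂ (G.map₂ (η.naturality f).hom) ≫ H.map₂ (G.mapComp _ _).hom ≫
              (H.mapComp _ _).hom := by simp
      exact shift_aux _ _ h)

def ascInvFirst {F₁ F₂ : A ⥤ᵖ B} (η : F₁ ⟶ F₂) (G : B ⥤ᵖ C) (H : C ⥤ᵖ D) :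
    postW (postW η G) H ≫ ascInv F₂ G H ≅ ascInv F₁ G H ≫ postW η (G.comp H) :=
  Pseudofunctor.StrongTrans.isoMk (fun a => ρ_ (H.map (G.map (η.app a))) ≪≫ (λ_ _).symm)
    (fun {a b} f => by
      have h : ((H.mapComp _ _).inv ≫ H.map₂ (G.mapComp _ _).inv) ≫
            H.map₂ (G.map₂ (η.naturality f).hom) ≫ H.map₂ (G.mapComp _ _).hom ≫
              (H.mapComp _ _).hom =
          (H.mapComp _ _).inv ≫ H.map₂ ((G.mapComp _ _).inv ≫
            G.map₂ (η.naturality f).hom ≫ (G.mapComp _ _).hom) ≫ (H.mapComp _ _).hom := by simp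
      exact shift_aux _ _ h)

/-- Naturality of the associator in its middle argument. -/
def ascMid (F : A ⥤ᵖ B) {G₁ G₂ : B ⥤ᵖ C} (θ : G₁ ⟶ G₂) (H : C ⥤ᵖ D) :
    preW F (postW θ H) ≫ asc F G₂ H ≅ asc F G₁ H ≫ postW (preW F θ) H :=
  Pseudofunctor.StrongTrans.isoMk (fun a => ρ_ (H.map (θ.app (F.obj a))) ≪≫ (λ_ _).symm)
    (fun f => shift_aux ((H.mapComp _ _).inv ≫ H.map₂ (θ.naturality (F.map f)).hom ≫
      (H.mapComp _ _).hom) _ rfl)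

/-- Naturality of the associator in its last argument. -/
def ascInvLast (F : A ⥤ᵖ B) (G : B ⥤ᵖ C) {H₁ H₂ : C ⥤ᵖ D} (θ : H₁ ⟶ H₂) :
    preW (F.comp G) θ ≫ ascInv F G H₂ ≅ ascInv F G H₁ ≫ preW F (preW G θ) :=
  Pseudofunctor.StrongTrans.isoMk (fun a => ρ_ (θ.app (G.obj (F.obj a))) ≪≫ (λ_ _).symm)
    (fun f => shift_aux (θ.naturality (G.map (F.map f))).hom _ rfl)

/-- Naturality of the unitors. -/
def runitNat {F₁ F₂ : A ⥤ᵖ B} (η : F₁ ⟶ F₂) :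
    postW η (Pseudofunctor.id B) ≫ runit F₂ ≅ runit F₁ ≫ η :=
  Pseudofunctor.StrongTrans.isoMk (fun a => ρ_ (η.app a) ≪≫ (λ_ _).symm)
    (fun f => shift_aux (η.naturality f).hom (𝟙 _ ≫ (η.naturality f).hom ≫ 𝟙 _) (by simp))

def lunitNat {G₁ G₂ : A ⥤ᵖ B} (θ : G₁ ⟶ G₂) :
    preW (Pseudofunctor.id A) θ ≫ lunit G₂ ≅ lunit G₁ ≫ θ :=
  Pseudofunctor.StrongTrans.isoMk (fun a => ρ_ (θ.app a) ≪≫ (λ_ _).symm)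
    (fun f => shift_aux (θ.naturality f).hom _ rfl)

def lunitInvNat {G₁ G₂ : A ⥤ᵖ B} (θ : G₁ ⟶ G₂) :
    θ ≫ lunitInv G₂ ≅ lunitInv G₁ ≫ preW (Pseudofunctor.id A) θ :=
  Pseudofunctor.StrongTrans.isoMk (fun a => ρ_ (θ.app a) ≪≫ (λ_ _).symm)
    (fun f => shift_aux (θ.naturality f).hom _ rfl)

/-- `N` is the canonical 2-cell between 1-morphisms that are isomorphic to identities. -/
def IdLike {x y : D} (f : x ⟶ y) {u : x ⟶ x} {v : y ⟶ y} (N : f ≫ v ⟶ u ≫ f)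
    (e : u ≅ 𝟙 x) (e' : v ≅ 𝟙 y) : Prop :=
  N = f ◁ e'.hom ≫ (ρ_ f).hom ≫ (λ_ f).inv ≫ e.inv ▷ f

def idE {x : D} {u v : x ⟶ x} (e : u ≅ 𝟙 x) (e' : v ≅ 𝟙 x) : u ≫ v ≅ 𝟙 x :=
  whiskerRightIso e v ≪≫ λ_ v ≪≫ e'

def mapE (G : C ⥤ᵖ D) {x : C} {u : x ⟶ x} (e : u ≅ 𝟙 x) : G.map u ≅ 𝟙 (G.obj x) :=
  G.map₂Iso e ≪≫ G.mapId x

theorem IdLike.refl {x y : D} (f : x ⟶ y) :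
    IdLike f ((ρ_ f).hom ≫ (λ_ f).inv) (Iso.refl (𝟙 x)) (Iso.refl (𝟙 y)) := by
  simp [IdLike]

theorem IdLike.comp {x y : D} {f : x ⟶ y} {u u' : x ⟶ x} {v v' : y ⟶ y}
    {N : f ≫ v ⟶ u ≫ f} {N' : f ≫ v' ⟶ u' ≫ f} {e : u ≅ 𝟙 x} {e' : v ≅ 𝟙 y}
    {d : u' ≅ 𝟙 x} {d' : v' ≅ 𝟙 y} (h : IdLike f N e e') (h' : IdLike f N' d d') :
    IdLike f ((α_ _ _ _).inv ≫ N ▷ v' ≫ (α_ _ _ _).hom ≫ u ◁ N' ≫ (α_ _ _ _).inv)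
      (idE e d) (idE e' d') := by
  unfold IdLike at *
  subst h h'
  simp only [idE, Iso.trans_hom, Iso.trans_inv, whiskerRightIso_hom, whiskerRightIso_inv]
  have h1 : e.inv ▷ f ▷ v' ≫ (α_ u f v').hom ≫ u ◁ (f ◁ d'.hom) =
      (α_ _ _ _).hom ≫ (𝟙 x) ◁ (f ◁ d'.hom) ≫ e.inv ▷ (f ≫ 𝟙 y) := by
    rw [Bicategory.associator_naturality_left_assoc, whisker_exchange]
  simp only [Bicategory.comp_whiskerRight, Bicategory.whiskerLeft_comp, Category.assoc]
  rw [reassoc_of% h1]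
  have h2 : e.inv ▷ (f ≫ 𝟙 y) ≫ u ◁ (ρ_ f).hom ≫ u ◁ (λ_ f).inv ≫ u ◁ (d.inv ▷ f) ≫
      (α_ u u' f).inv = 𝟙 x ◁ ((ρ_ f).hom ≫ (λ_ f).inv ≫ d.inv ▷ f) ≫ (α_ _ _ _).inv ≫
        (e.inv ▷ u') ▷ f := by
    rw [← whisker_exchange_assoc, ← whisker_exchange_assoc, ← whisker_exchange_assoc]
    simp
  rw [h2]
  simp only [id_whiskerLeft, Category.assoc, Iso.inv_hom_id_assoc, Bicategory.whiskerLeft_comp,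
    leftUnitor_inv_whiskerRight, whisker_assoc, Iso.hom_inv_id_assoc]
  simp

theorem IdLike.map (G : C ⥤ᵖ D) {x y : C} {f : x ⟶ y} {u : x ⟶ x} {v : y ⟶ y}
    {N : f ≫ v ⟶ u ≫ f} {e : u ≅ 𝟙 x} {e' : v ≅ 𝟙 y} (h : IdLike f N e e') :
    IdLike (G.map f) ((G.mapComp _ _).inv ≫ G.map₂ N ≫ (G.mapComp _ _).hom)
      (mapE G e) (mapE G e') := by
  unfold IdLike at *
  subst h
  simp [mapE, map₂_leftUnitor_inv]

theorem IdLike.nat {x y : D} {f : x ⟶ y} {u u' : x ⟶ x} {v v' : y ⟶ y}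
    {N : f ≫ v ⟶ u ≫ f} {N' : f ≫ v' ⟶ u' ≫ f} {e : u ≅ 𝟙 x} {e' : v ≅ 𝟙 y}
    {d : u' ≅ 𝟙 x} {d' : v' ≅ 𝟙 y} (h : IdLike f N e e') (h' : IdLike f N' d d') :
    f ◁ (e' ≪≫ d'.symm).hom ≫ N' = N ≫ (e ≪≫ d.symm).hom ▷ f := by
  unfold IdLike at *
  subst h h'
  simp [← Bicategory.comp_whiskerRight]
variable {E : Type uE} [Bicategory.{wE, vE} E]

/-- The pentagonators. -/
def pentagon₁ (F : A ⥤ᵖ B) (G : B ⥤ᵖ C) (H : C ⥤ᵖ D) (K : D ⥤ᵖ E) :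
    ascInv F G (H.comp K) ≫ preW F (asc G H K) ≫ asc F (G.comp H) K ≅
      asc (F.comp G) H K ≫ postW (ascInv F G H) K :=
  Pseudofunctor.StrongTrans.isoMk
    (fun a => (idE (Iso.refl _) (idE (Iso.refl _) (Iso.refl _)) :
        𝟙 (K.obj (H.obj (G.obj (F.obj a)))) ≫ 𝟙 _ ≫ 𝟙 _ ≅ 𝟙 _) ≪≫
      (idE (Iso.refl _) (mapE K (Iso.refl _)) : 𝟙 _ ≫ K.map (𝟙 _) ≅ 𝟙 _).symm)
    (fun f => IdLike.nat ((IdLike.refl _).comp ((IdLike.refl _).comp (IdLike.refl _)))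
      ((IdLike.refl _).comp ((IdLike.refl (H.map (G.map (F.map f)))).map K)))

def pentagon₂ (F : A ⥤ᵖ B) (G : B ⥤ᵖ C) (H : C ⥤ᵖ D) (K : D ⥤ᵖ E) :
    postW (ascInv F G H) K ≫ ascInv F (G.comp H) K ≫ preW F (ascInv G H K) ≅
      ascInv (F.comp G) H K ≫ ascInv F G (H.comp K) :=
  Pseudofunctor.StrongTrans.isoMk
    (fun a => (idE (mapE K (Iso.refl _)) (idE (Iso.refl _) (Iso.refl _)) :
        K.map (𝟙 (H.obj (G.obj (F.obj a)))) ≫ 𝟙 _ ≫ 𝟙 _ ≅ 𝟙 _) ≪≫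
      (idE (Iso.refl _) (Iso.refl _) : 𝟙 _ ≫ 𝟙 _ ≅ 𝟙 _).symm)
    (fun f => IdLike.nat (((IdLike.refl (H.map (G.map (F.map f)))).map K).comp
      ((IdLike.refl _).comp (IdLike.refl _))) ((IdLike.refl _).comp (IdLike.refl _)))

def pentagon₃ (F : A ⥤ᵖ B) (G : B ⥤ᵖ C) (H : C ⥤ᵖ D) (K : D ⥤ᵖ E) :
    asc F (G.comp H) K ≫ postW (asc F G H) K ≫ ascInv (F.comp G) H K ≫ ascInv F G (H.comp K) ≅
      preW F (ascInv G H K) :=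
  Pseudofunctor.StrongTrans.isoMk
    (fun a => (idE (Iso.refl _) (idE (mapE K (Iso.refl _)) (idE (Iso.refl _) (Iso.refl _))) :
        𝟙 _ ≫ K.map (𝟙 (H.obj (G.obj (F.obj a)))) ≫ 𝟙 _ ≫ 𝟙 _ ≅ 𝟙 _) ≪≫
      (Iso.refl (𝟙 _)).symm)
    (fun f => IdLike.nat ((IdLike.refl _).comp
      (((IdLike.refl (H.map (G.map (F.map f)))).map K).comp
      ((IdLike.refl _).comp (IdLike.refl _)))) (IdLike.refl _))

/-- The compatibility of the associators and the unitors. -/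
def unitRight (F : A ⥤ᵖ B) (G : B ⥤ᵖ C) :
    ascInv F G (Pseudofunctor.id C) ≫ preW F (runit G) ≅ runit (F.comp G) :=
  Pseudofunctor.StrongTrans.isoMk
    (fun a => (idE (Iso.refl _) (Iso.refl _) : 𝟙 (G.obj (F.obj a)) ≫ 𝟙 _ ≅ 𝟙 _) ≪≫
      (Iso.refl (𝟙 _)).symm)
    (fun _ => IdLike.nat ((IdLike.refl _).comp (IdLike.refl _)) (IdLike.refl _))

def unitLeft (F : A ⥤ᵖ B) (G : B ⥤ᵖ C) :
    asc (Pseudofunctor.id A) F G ≫ postW (lunit F) G ≅ lunit (F.comp G) :=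
  Pseudofunctor.StrongTrans.isoMk
    (fun a => (idE (Iso.refl _) (mapE G (Iso.refl _)) : 𝟙 _ ≫ G.map (𝟙 (F.obj a)) ≅ 𝟙 _) ≪≫
      (Iso.refl (𝟙 _)).symm)
    (fun f => IdLike.nat ((IdLike.refl _).comp ((IdLike.refl (F.map f)).map G)) (IdLike.refl _))

def unitMid (F : A ⥤ᵖ B) (G : B ⥤ᵖ C) :
    preW F (lunit G) ≅ asc F (Pseudofunctor.id B) G ≫ postW (runit F) G :=
  Pseudofunctor.StrongTrans.isoMk
    (fun a => Iso.refl (𝟙 _) ≪≫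
      (idE (Iso.refl _) (mapE G (Iso.refl _)) : 𝟙 _ ≫ G.map (𝟙 (F.obj a)) ≅ 𝟙 _).symm)
    (fun f => IdLike.nat (IdLike.refl _) ((IdLike.refl _).comp ((IdLike.refl (F.map f)).map G)))

def unitMidInv (F : A ⥤ᵖ B) (G : B ⥤ᵖ C) :
    postW (runitInv F) G ≅ preW F (lunitInv G) ≫ asc F (Pseudofunctor.id B) G :=
  Pseudofunctor.StrongTrans.isoMk
    (fun a => (mapE G (Iso.refl (𝟙 (F.obj a)))) ≪≫
      (idE (Iso.refl _) (Iso.refl _) : 𝟙 _ ≫ 𝟙 _ ≅ 𝟙 _).symm)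
    (fun f => IdLike.nat ((IdLike.refl (F.map f)).map G) ((IdLike.refl _).comp (IdLike.refl _)))

/-- The pre-whiskering `τ_P : G P ⟶ P` of `τ : G ⟶ Id`, unitor included. -/
def preWCounit (P : A ⥤ᵖ B) {G : B ⥤ᵖ B} (τ : G ⟶ Pseudofunctor.id B) : P.comp G ⟶ P :=
  preW P τ ≫ runit P

/-- The pre-whiskering `η_P : P ⟶ G P` of `η : Id ⟶ G`, unitor included. -/
def preWUnit (P : A ⥤ᵖ B) {G : B ⥤ᵖ B} (η : Pseudofunctor.id B ⟶ G) : P ⟶ P.comp G :=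
  runitInv P ≫ preW P η

/-- The post-whiskering `G(τ) : G P ⟶ G` of `τ : P ⟶ Id`, unitor included. -/
def postWCounit {P : A ⥤ᵖ A} (τ : P ⟶ Pseudofunctor.id A) (G : A ⥤ᵖ B) : P.comp G ⟶ G :=
  postW τ G ≫ lunit G

/-- The post-whiskering `G(η) : G ⟶ G P` of `η : Id ⟶ P`, unitor included. -/
def postWUnit {P : A ⥤ᵖ A} (η : Pseudofunctor.id A ⟶ P) (G : A ⥤ᵖ B) : G ⟶ P.comp G :=
  lunitInv G ≫ postW η G

def preWCounitComp (P : A ⥤ᵖ B) {G G' : B ⥤ᵖ B} (σ : G ⟶ G') (τ : G' ⟶ Pseudofunctor.id B) :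
    preWCounit P (σ ≫ τ) ≅ preW P σ ≫ preWCounit P τ :=
  whiskerRightIso (preWComp P σ τ) (runit P) ≪≫ α_ _ _ _

def postWUnitComp {P P' : A ⥤ᵖ A} (η : Pseudofunctor.id A ⟶ P) (σ : P ⟶ P') (G : A ⥤ᵖ B) :
    postWUnit (η ≫ σ) G ≅ postWUnit η G ≫ postW σ G :=
  whiskerLeftIso (lunitInv G) (postWComp η σ G) ≪≫ (α_ _ _ _).symm

/-- The exchange laws for transformations to or from an identity pseudofunctor. -/
def exchCounitPre {P₁ P₂ : A ⥤ᵖ B} (η : P₁ ⟶ P₂) {G : B ⥤ᵖ B} (τ : G ⟶ Pseudofunctor.id B) :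
    postW η G ≫ preWCounit P₂ τ ≅ preWCounit P₁ τ ≫ η :=
  calc
    postW η G ≫ preW P₂ τ ≫ runit P₂
      ≅ (postW η G ≫ preW P₂ τ) ≫ runit P₂ := (α_ _ _ _).symm
    _ ≅ (preW P₁ τ ≫ postW η (Pseudofunctor.id B)) ≫ runit P₂ :=
        whiskerRightIso (exch η τ) _
    _ ≅ preW P₁ τ ≫ postW η (Pseudofunctor.id B) ≫ runit P₂ := α_ _ _ _
    _ ≅ preW P₁ τ ≫ runit P₁ ≫ η := whiskerLeftIso _ (runitNat η)
    _ ≅ (preW P₁ τ ≫ runit P₁) ≫ η := (α_ _ _ _).symm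

def exchCounitPost {P : A ⥤ᵖ A} (τ : P ⟶ Pseudofunctor.id A) {G₁ G₂ : A ⥤ᵖ B} (θ : G₁ ⟶ G₂) :
    preW P θ ≫ postWCounit τ G₂ ≅ postWCounit τ G₁ ≫ θ :=
  calc
    preW P θ ≫ postW τ G₂ ≫ lunit G₂
      ≅ (preW P θ ≫ postW τ G₂) ≫ lunit G₂ := (α_ _ _ _).symm
    _ ≅ (postW τ G₁ ≫ preW (Pseudofunctor.id A) θ) ≫ lunit G₂ :=
        whiskerRightIso (exch τ θ).symm _
    _ ≅ postW τ G₁ ≫ preW (Pseudofunctor.id A) θ ≫ lunit G₂ := α_ _ _ _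
    _ ≅ postW τ G₁ ≫ lunit G₁ ≫ θ := whiskerLeftIso _ (lunitNat θ)
    _ ≅ (postW τ G₁ ≫ lunit G₁) ≫ θ := (α_ _ _ _).symm

def exchUnitPost {P : A ⥤ᵖ A} (η : Pseudofunctor.id A ⟶ P) {G₁ G₂ : A ⥤ᵖ B} (θ : G₁ ⟶ G₂) :
    postWUnit η G₁ ≫ preW P θ ≅ θ ≫ postWUnit η G₂ :=
  calc
    (lunitInv G₁ ≫ postW η G₁) ≫ preW P θ
      ≅ lunitInv G₁ ≫ postW η G₁ ≫ preW P θ := α_ _ _ _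
    _ ≅ lunitInv G₁ ≫ preW (Pseudofunctor.id A) θ ≫ postW η G₂ :=
        whiskerLeftIso _ (exch η θ)
    _ ≅ (lunitInv G₁ ≫ preW (Pseudofunctor.id A) θ) ≫ postW η G₂ := (α_ _ _ _).symm
    _ ≅ (θ ≫ lunitInv G₂) ≫ postW η G₂ := whiskerRightIso (lunitInvNat θ).symm _
    _ ≅ θ ≫ lunitInv G₂ ≫ postW η G₂ := α_ _ _ _

/-- The associativity of whiskering for transformations to or from an identity pseudofunctor. -/
def ascCounitLast (F : A ⥤ᵖ B) (G : B ⥤ᵖ C) {P : C ⥤ᵖ C} (τ : P ⟶ Pseudofunctor.id C) :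
    ascInv F G P ≫ preW F (preWCounit G τ) ≅ preWCounit (F.comp G) τ :=
  calc
    ascInv F G P ≫ preW F (preW G τ ≫ runit G)
      ≅ ascInv F G P ≫ preW F (preW G τ) ≫ preW F (runit G) :=
        whiskerLeftIso _ (preWComp F (preW G τ) (runit G))
    _ ≅ (ascInv F G P ≫ preW F (preW G τ)) ≫ preW F (runit G) := (α_ _ _ _).symm
    _ ≅ (preW (F.comp G) τ ≫ ascInv F G (Pseudofunctor.id C)) ≫ preW F (runit G) :=
        whiskerRightIso (ascInvLast F G τ).symm _
    _ ≅ preW (F.comp G) τ ≫ ascInv F G (Pseudofunctor.id C) ≫ preW F (runit G) := α_ _ _ _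
    _ ≅ preW (F.comp G) τ ≫ runit (F.comp G) := whiskerLeftIso _ (unitRight F G)

def ascCounitFirst {P : A ⥤ᵖ A} (τ : P ⟶ Pseudofunctor.id A) (F : A ⥤ᵖ B) (G : B ⥤ᵖ C) :
    asc P F G ≫ postW (postWCounit τ F) G ≅ postWCounit τ (F.comp G) :=
  calc
    asc P F G ≫ postW (postW τ F ≫ lunit F) G
      ≅ asc P F G ≫ postW (postW τ F) G ≫ postW (lunit F) G :=
        whiskerLeftIso _ (postWComp (postW τ F) (lunit F) G)
    _ ≅ (asc P F G ≫ postW (postW τ F) G) ≫ postW (lunit F) G := (α_ _ _ _).symm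
    _ ≅ (postW τ (F.comp G) ≫ asc (Pseudofunctor.id A) F G) ≫ postW (lunit F) G :=
        whiskerRightIso (ascFirst τ F G).symm _
    _ ≅ postW τ (F.comp G) ≫ asc (Pseudofunctor.id A) F G ≫ postW (lunit F) G := α_ _ _ _
    _ ≅ postW τ (F.comp G) ≫ lunit (F.comp G) := whiskerLeftIso _ (unitLeft F G)

def ascCounitMid (F : A ⥤ᵖ B) {P : B ⥤ᵖ B} (τ : P ⟶ Pseudofunctor.id B) (G : B ⥤ᵖ C) :
    preW F (postWCounit τ G) ≅ asc F P G ≫ postW (preWCounit F τ) G :=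
  calc
    preW F (postW τ G ≫ lunit G)
      ≅ preW F (postW τ G) ≫ preW F (lunit G) := preWComp F (postW τ G) (lunit G)
    _ ≅ preW F (postW τ G) ≫ asc F (Pseudofunctor.id B) G ≫ postW (runit F) G :=
        whiskerLeftIso _ (unitMid F G)
    _ ≅ (preW F (postW τ G) ≫ asc F (Pseudofunctor.id B) G) ≫ postW (runit F) G :=
        (α_ _ _ _).symm
    _ ≅ (asc F P G ≫ postW (preW F τ) G) ≫ postW (runit F) G :=
        whiskerRightIso (ascMid F τ G) _
    _ ≅ asc F P G ≫ postW (preW F τ) G ≫ postW (runit F) G := α_ _ _ _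
    _ ≅ asc F P G ≫ postW (preW F τ ≫ runit F) G :=
        whiskerLeftIso _ (postWComp (preW F τ) (runit F) G).symm

def ascUnitMid (F : A ⥤ᵖ B) {P : B ⥤ᵖ B} (η : Pseudofunctor.id B ⟶ P) (G : B ⥤ᵖ C) :
    postW (preWUnit F η) G ≅ preW F (postWUnit η G) ≫ asc F P G :=
  calc
    postW (runitInv F ≫ preW F η) G
      ≅ postW (runitInv F) G ≫ postW (preW F η) G := postWComp (runitInv F) (preW F η) G
    _ ≅ (preW F (lunitInv G) ≫ asc F (Pseudofunctor.id B) G) ≫ postW (preW F η) G :=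
        whiskerRightIso (unitMidInv F G) _
    _ ≅ preW F (lunitInv G) ≫ asc F (Pseudofunctor.id B) G ≫ postW (preW F η) G := α_ _ _ _
    _ ≅ preW F (lunitInv G) ≫ preW F (postW η G) ≫ asc F P G :=
        whiskerLeftIso _ (ascMid F η G).symm
    _ ≅ (preW F (lunitInv G) ≫ preW F (postW η G)) ≫ asc F P G := (α_ _ _ _).symm
    _ ≅ preW F (lunitInv G ≫ postW η G) ≫ asc F P G :=
        whiskerRightIso (preWComp F (lunitInv G) (postW η G)).symm _

/-- A biadjunction `L ⊣ R`, in the sense of invertible triangle modifications that are not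
required to satisfy the swallowtail equations. -/
structure Biadjunction (L : A ⥤ᵖ B) (R : B ⥤ᵖ A) where
  unit : Pseudofunctor.id A ⟶ L.comp R
  counit : R.comp L ⟶ Pseudofunctor.id B
  leftTriangle : postWUnit unit L ≫ ascInv L R L ≫ preWCounit L counit ≅ 𝟙 L
  rightTriangle : preWUnit R unit ≫ asc R L R ≫ postWCounit counit R ≅ 𝟙 R

section Coinverters

variable {x y : D} {f g : x ⟶ y}

/-- The co-inverter cones of `φ` with a given vertex `w`: the 1-morphisms `h` for which the
whiskering `h * φ` is invertible. -/
def coinvCone (φ : f ⟶ g) (w : D) : ObjectProperty (y ⟶ w) :=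
  fun h => IsIso (φ ▷ h)

theorem coinvCone_comp (φ : f ⟶ g) {z w : D} {p : y ⟶ z} (hp : coinvCone φ z p) (h : z ⟶ w) :
    coinvCone φ w (p ≫ h) := by
  unfold coinvCone at *
  rw [Bicategory.whiskerRight_comp]
  infer_instance

/-- The functor `h ↦ h ∘ p` from `Hom(z, w)` to the full subcategory of `Hom(y, w)` on the
co-inverter cones of `φ`. -/
def coinvComparison (φ : f ⟶ g) {z : D} {p : y ⟶ z} (hp : coinvCone φ z p) (w : D) :
    (z ⟶ w) ⥤ (coinvCone φ w).FullSubcategory :=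
  (coinvCone φ w).lift (precomp w p) (coinvCone_comp φ hp)

/-- `(z, p)` is a co-inverter of `φ`: a universal co-inverter cone. -/
structure IsCoinverter (φ : f ⟶ g) {z : D} (p : y ⟶ z) : Prop where
  cone : coinvCone φ z p
  universal (w : D) : (coinvComparison φ cone w).IsEquivalence

/-- `p` is co-fully faithful: pre-composition with `p` is fully faithful. -/
def CoFullyFaithful (p : x ⟶ y) : Prop :=
  ∀ w : D, (precomp w p).Full ∧ (precomp w p).Faithful

end Coinverters

section Transport

variable {U H : A ⥤ᵖ C} {T : C ⥤ᵖ A}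

/-- The counit of `U ⊣ T` obtained from `H ⊣ T` and an equivalence `U ≌ H`. -/
def counitAlong (Γ : Bicategory.Equivalence U H) (adj : Biadjunction H T) :
    T.comp U ⟶ Pseudofunctor.id C :=
  preW T Γ.hom ≫ adj.counit

/-- The unit of `U ⊣ T` obtained from `H ⊣ T` and an equivalence `U ≌ H`. -/
def unitAlong (Γ : Bicategory.Equivalence U H) (adj : Biadjunction H T) :
    Pseudofunctor.id A ⟶ U.comp T :=
  adj.unit ≫ postW Γ.inv T

/-- The left triangle modification of `U ⊣ T` obtained from that of `H ⊣ T`. -/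
def leftTriangleAlong (Γ : Bicategory.Equivalence U H) (adj : Biadjunction H T) :
    postWUnit (unitAlong Γ adj) U ≫ ascInv U T U ≫ preWCounit U (counitAlong Γ adj) ≅ 𝟙 U :=
  calc
    postWUnit (adj.unit ≫ postW Γ.inv T) U ≫ ascInv U T U ≫
        preWCounit U (preW T Γ.hom ≫ adj.counit)
      ≅ (postWUnit adj.unit U ≫ postW (postW Γ.inv T) U) ≫ ascInv U T U ≫
          preW U (preW T Γ.hom) ≫ preWCounit U adj.counit :=
        whiskerRightIso (postWUnitComp _ _ _) _ ≪≫
          whiskerLeftIso _ (whiskerLeftIso _ (preWCounitComp _ _ _))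
    _ ≅ postWUnit adj.unit U ≫ (postW (postW Γ.inv T) U ≫ ascInv U T U) ≫
          preW U (preW T Γ.hom) ≫ preWCounit U adj.counit := ⊗𝟙
    _ ≅ postWUnit adj.unit U ≫ (ascInv H T U ≫ postW Γ.inv (T.comp U)) ≫
          preW U (preW T Γ.hom) ≫ preWCounit U adj.counit :=
        whiskerLeftIso _ (whiskerRightIso (ascInvFirst Γ.inv T U) _)
    _ ≅ postWUnit adj.unit U ≫ ascInv H T U ≫ (postW Γ.inv (T.comp U) ≫
          preW U (preW T Γ.hom)) ≫ preWCounit U adj.counit := ⊗𝟙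
    _ ≅ postWUnit adj.unit U ≫ ascInv H T U ≫ (preW H (preW T Γ.hom) ≫
          postW Γ.inv (T.comp H)) ≫ preWCounit U adj.counit :=
        whiskerLeftIso _ (whiskerLeftIso _ (whiskerRightIso (exch Γ.inv (preW T Γ.hom)) _))
    _ ≅ postWUnit adj.unit U ≫ (ascInv H T U ≫ preW H (preW T Γ.hom)) ≫
          postW Γ.inv (T.comp H) ≫ preWCounit U adj.counit := ⊗𝟙
    _ ≅ postWUnit adj.unit U ≫ (preW (H.comp T) Γ.hom ≫ ascInv H T H) ≫
          preWCounit H adj.counit ≫ Γ.inv :=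
        whiskerLeftIso _ (whiskerRightIso (ascInvLast H T Γ.hom).symm _ ≪≫
          whiskerLeftIso _ (exchCounitPre Γ.inv adj.counit))
    _ ≅ (postWUnit adj.unit U ≫ preW (H.comp T) Γ.hom) ≫
          ascInv H T H ≫ preWCounit H adj.counit ≫ Γ.inv := ⊗𝟙
    _ ≅ (Γ.hom ≫ postWUnit adj.unit H) ≫ ascInv H T H ≫ preWCounit H adj.counit ≫ Γ.inv :=
        whiskerRightIso (exchUnitPost adj.unit Γ.hom) _
    _ ≅ Γ.hom ≫ (postWUnit adj.unit H ≫ ascInv H T H ≫ preWCounit H adj.counit) ≫ Γ.inv :=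
        ⊗𝟙
    _ ≅ Γ.hom ≫ 𝟙 H ≫ Γ.inv := whiskerLeftIso _ (whiskerRightIso adj.leftTriangle _)
    _ ≅ Γ.hom ≫ Γ.inv := ⊗𝟙
    _ ≅ 𝟙 U := Γ.unit.symm

end Transport

section Triangle

variable {F : A ⥤ᵖ B} {R : B ⥤ᵖ A} {H : A ⥤ᵖ C} {T : C ⥤ᵖ A} (G : B ⥤ᵖ C)
  (X : R.comp F ⟶ Pseudofunctor.id B)

/-- `(G F) R ≅ G (F R) ⟶ G`, the second map being `G(X)`. -/
def counitImage : R.comp (F.comp G) ⟶ G :=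
  asc R F G ≫ postWCounit X G

variable (adj : Biadjunction H T) (Γ : Bicategory.Equivalence (F.comp G) H)

/-- `Υ'' : G (F T) ≅ (G F) T ⟶ Id`. -/
def upsilon : (T.comp F).comp G ⟶ Pseudofunctor.id C :=
  ascInv T F G ≫ counitAlong Γ adj

/-- `Δ : R ⟶ (T (G F)) R ≅ T ((G F) R) ⟶ T G`. -/
def delta : R ⟶ G.comp T :=
  preWUnit R (unitAlong Γ adj) ≫ asc R (F.comp G) T ≫ postW (counitImage G X) T

/-- `Δ' : F R ⟶ F (T G) ≅ (F T) G`. -/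
def delta' : R.comp F ⟶ G.comp (T.comp F) :=
  postW (delta G X adj Γ) F ≫ ascInv G T F

/-- `Δ'' : (F R) (F R) ⟶ (F R) ((F T) G) ≅ ((F R) (F T)) G`. -/
def delta'' : (R.comp F).comp (R.comp F) ⟶ G.comp ((T.comp F).comp (R.comp F)) :=
  postW (delta' G X adj Γ) (R.comp F) ≫ ascInv G (T.comp F) (R.comp F)

/-- `K' : ((F T) G) (F T) ≅ (F T) (G (F T)) ⟶ F T`, the second map being `F T (Υ'')`. -/
def kappa' : (T.comp F).comp (G.comp (T.comp F)) ⟶ T.comp F :=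
  asc (T.comp F) G (T.comp F) ≫ postWCounit (upsilon G adj Γ) (T.comp F)

/-- `K : (F R) (F T) ⟶ ((F T) G) (F T) ⟶ F T`. -/
def kappa : (T.comp F).comp (R.comp F) ⟶ T.comp F :=
  preW (T.comp F) (delta' G X adj Γ) ≫ kappa' G adj Γ

/-- The invertible modification `φ₁ : (X_{F T})_G ∘ Δ'' ≅ Δ' ∘ X_{F R}`. -/
def phi₁ :
    delta'' G X adj Γ ≫ preW G (preWCounit (T.comp F) X) ≅
      preWCounit (R.comp F) X ≫ delta' G X adj Γ :=
  calc
    (postW (delta' G X adj Γ) (R.comp F) ≫ ascInv G (T.comp F) (R.comp F)) ≫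
        preW G (preWCounit (T.comp F) X)
      ≅ postW (delta' G X adj Γ) (R.comp F) ≫ ascInv G (T.comp F) (R.comp F) ≫
        preW G (preWCounit (T.comp F) X) := α_ _ _ _
    _ ≅ postW (delta' G X adj Γ) (R.comp F) ≫ preWCounit (G.comp (T.comp F)) X :=
        whiskerLeftIso _ (ascCounitLast G (T.comp F) X)
    _ ≅ preWCounit (R.comp F) X ≫ delta' G X adj Γ := exchCounitPre (delta' G X adj Γ) X

/-- The left triangle of `G F ⊣ T`, pre-whiskered by `R`. -/
def triangleAt (R : B ⥤ᵖ A) {U : A ⥤ᵖ C} (Γ : Bicategory.Equivalence U H) :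
    postW (preWUnit R (unitAlong Γ adj)) U ≫ postW (asc R U T) U ≫ ascInv (R.comp U) T U ≫
      preWCounit (R.comp U) (counitAlong Γ adj) ≅ 𝟙 (R.comp U) :=
  calc
    postW (preWUnit R (unitAlong Γ adj)) U ≫ postW (asc R U T) U ≫ ascInv (R.comp U) T U ≫
        preWCounit (R.comp U) (counitAlong Γ adj)
      ≅ (preW R (postWUnit (unitAlong Γ adj) U) ≫ asc R (U.comp T) U) ≫
          postW (asc R U T) U ≫ ascInv (R.comp U) T U ≫
          ascInv R U (T.comp U) ≫ preW R (preWCounit U (counitAlong Γ adj)) :=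
        whiskerRightIso (ascUnitMid R (unitAlong Γ adj) U) _ ≪≫
          whiskerLeftIso _ (whiskerLeftIso _ (whiskerLeftIso _
            (ascCounitLast R U (counitAlong Γ adj)).symm))
    _ ≅ preW R (postWUnit (unitAlong Γ adj) U) ≫
          (asc R (U.comp T) U ≫ postW (asc R U T) U ≫ ascInv (R.comp U) T U ≫
            ascInv R U (T.comp U)) ≫ preW R (preWCounit U (counitAlong Γ adj)) := ⊗𝟙
    _ ≅ preW R (postWUnit (unitAlong Γ adj) U) ≫ preW R (ascInv U T U) ≫
          preW R (preWCounit U (counitAlong Γ adj)) :=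
        whiskerLeftIso _ (whiskerRightIso (pentagon₃ R U T U) _)
    _ ≅ preW R (postWUnit (unitAlong Γ adj) U ≫ ascInv U T U ≫
          preWCounit U (counitAlong Γ adj)) :=
        whiskerLeftIso _ (preWComp R _ _).symm ≪≫ (preWComp R _ _).symm
    _ ≅ preW R (𝟙 U) := preWIso R (leftTriangleAlong Γ adj)
    _ ≅ 𝟙 (R.comp U) := preWId R U

/-- The composite of `Δ` and `Υ'` is the map `(G F) R ⟶ G` induced by `X`. -/
def deltaUpsilon :
    postW (delta G X adj Γ) (F.comp G) ≫ ascInv G T (F.comp G) ≫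
      preWCounit G (counitAlong Γ adj) ≅ counitImage G X :=
  calc
    postW (preWUnit R (unitAlong Γ adj) ≫ asc R (F.comp G) T ≫ postW (counitImage G X) T)
          (F.comp G) ≫ ascInv G T (F.comp G) ≫ preWCounit G (counitAlong Γ adj)
      ≅ (postW (preWUnit R (unitAlong Γ adj)) (F.comp G) ≫ postW (asc R (F.comp G) T) (F.comp G) ≫
          postW (postW (counitImage G X) T) (F.comp G)) ≫ ascInv G T (F.comp G) ≫
          preWCounit G (counitAlong Γ adj) :=
        whiskerRightIso (postWComp _ _ _ ≪≫ whiskerLeftIso _ (postWComp _ _ _)) _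
    _ ≅ postW (preWUnit R (unitAlong Γ adj)) (F.comp G) ≫ postW (asc R (F.comp G) T) (F.comp G) ≫
          (postW (postW (counitImage G X) T) (F.comp G) ≫ ascInv G T (F.comp G)) ≫
          preWCounit G (counitAlong Γ adj) := ⊗𝟙
    _ ≅ postW (preWUnit R (unitAlong Γ adj)) (F.comp G) ≫ postW (asc R (F.comp G) T) (F.comp G) ≫
          (ascInv (R.comp (F.comp G)) T (F.comp G) ≫
            postW (counitImage G X) (T.comp (F.comp G))) ≫
          preWCounit G (counitAlong Γ adj) :=
        whiskerLeftIso _ (whiskerLeftIso _ (whiskerRightIso (ascInvFirst _ _ _) _))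
    _ ≅ postW (preWUnit R (unitAlong Γ adj)) (F.comp G) ≫ postW (asc R (F.comp G) T) (F.comp G) ≫
          ascInv (R.comp (F.comp G)) T (F.comp G) ≫
            postW (counitImage G X) (T.comp (F.comp G)) ≫ preWCounit G (counitAlong Γ adj) := ⊗𝟙
    _ ≅ postW (preWUnit R (unitAlong Γ adj)) (F.comp G) ≫ postW (asc R (F.comp G) T) (F.comp G) ≫
          ascInv (R.comp (F.comp G)) T (F.comp G) ≫
            preWCounit (R.comp (F.comp G)) (counitAlong Γ adj) ≫ counitImage G X :=
        whiskerLeftIso _ (whiskerLeftIso _ (whiskerLeftIso _ (exchCounitPre _ _)))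
    _ ≅ (postW (preWUnit R (unitAlong Γ adj)) (F.comp G) ≫
          postW (asc R (F.comp G) T) (F.comp G) ≫ ascInv (R.comp (F.comp G)) T (F.comp G) ≫
            preWCounit (R.comp (F.comp G)) (counitAlong Γ adj)) ≫ counitImage G X := ⊗𝟙
    _ ≅ 𝟙 _ ≫ counitImage G X := whiskerRightIso (triangleAt adj R Γ) _
    _ ≅ counitImage G X := λ_ _

/-- The modification `φ₂'' : Υ''_G ∘ A⁻¹ ∘ G(Δ') ≅ G(X)`. -/
def phi₂'' :
    postW (delta' G X adj Γ) G ≫ ascInv G (T.comp F) G ≫ preWCounit G (upsilon G adj Γ) ≅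
      postWCounit X G :=
  calc
    postW (postW (delta G X adj Γ) F ≫ ascInv G T F) G ≫ ascInv G (T.comp F) G ≫
        preWCounit G (ascInv T F G ≫ counitAlong Γ adj)
      ≅ (postW (postW (delta G X adj Γ) F) G ≫ postW (ascInv G T F) G) ≫
          ascInv G (T.comp F) G ≫ preW G (ascInv T F G) ≫ preWCounit G (counitAlong Γ adj) :=
        whiskerRightIso (postWComp _ _ _) _ ≪≫
          whiskerLeftIso _ (whiskerLeftIso _ (preWCounitComp _ _ _))
    _ ≅ postW (postW (delta G X adj Γ) F) G ≫ (postW (ascInv G T F) G ≫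
          ascInv G (T.comp F) G ≫ preW G (ascInv T F G)) ≫ preWCounit G (counitAlong Γ adj) := ⊗𝟙
    _ ≅ postW (postW (delta G X adj Γ) F) G ≫ (ascInv (G.comp T) F G ≫
          ascInv G T (F.comp G)) ≫ preWCounit G (counitAlong Γ adj) :=
        whiskerLeftIso _ (whiskerRightIso (pentagon₂ G T F G) _)
    _ ≅ (postW (postW (delta G X adj Γ) F) G ≫ ascInv (G.comp T) F G) ≫
          ascInv G T (F.comp G) ≫ preWCounit G (counitAlong Γ adj) := ⊗𝟙
    _ ≅ (ascInv R F G ≫ postW (delta G X adj Γ) (F.comp G)) ≫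
          ascInv G T (F.comp G) ≫ preWCounit G (counitAlong Γ adj) :=
        whiskerRightIso (ascInvFirst _ _ _) _
    _ ≅ ascInv R F G ≫ postW (delta G X adj Γ) (F.comp G) ≫
          ascInv G T (F.comp G) ≫ preWCounit G (counitAlong Γ adj) := α_ _ _ _
    _ ≅ ascInv R F G ≫ asc R F G ≫ postWCounit X G :=
        whiskerLeftIso _ (deltaUpsilon G X adj Γ)
    _ ≅ (ascInv R F G ≫ asc R F G) ≫ postWCounit X G := (α_ _ _ _).symm
    _ ≅ 𝟙 _ ≫ postWCounit X G := whiskerRightIso (ascInvAsc R F G) _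
    _ ≅ postWCounit X G := λ_ _

/-- The invertible modification `K'_G ∘ A⁻¹ ∘ ((F T) G)(Δ') ≅ ((F T) G)(X)`. -/
def phi₂' :
    postW (delta' G X adj Γ) (G.comp (T.comp F)) ≫
      ascInv G (T.comp F) (G.comp (T.comp F)) ≫ preW G (kappa' G adj Γ) ≅
      postWCounit X (G.comp (T.comp F)) :=
  calc
    postW (delta' G X adj Γ) (G.comp (T.comp F)) ≫ ascInv G (T.comp F) (G.comp (T.comp F)) ≫
        preW G (asc (T.comp F) G (T.comp F) ≫ postWCounit (upsilon G adj Γ) (T.comp F))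
      ≅ postW (delta' G X adj Γ) (G.comp (T.comp F)) ≫ ascInv G (T.comp F) (G.comp (T.comp F)) ≫
          preW G (asc (T.comp F) G (T.comp F)) ≫ asc G ((T.comp F).comp G) (T.comp F) ≫
          postW (preWCounit G (upsilon G adj Γ)) (T.comp F) :=
        whiskerLeftIso _ (whiskerLeftIso _ (preWComp G _ _ ≪≫
          whiskerLeftIso _ (ascCounitMid G (upsilon G adj Γ) (T.comp F))))
    _ ≅ postW (delta' G X adj Γ) (G.comp (T.comp F)) ≫
          (ascInv G (T.comp F) (G.comp (T.comp F)) ≫ preW G (asc (T.comp F) G (T.comp F)) ≫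
            asc G ((T.comp F).comp G) (T.comp F)) ≫
          postW (preWCounit G (upsilon G adj Γ)) (T.comp F) := ⊗𝟙
    _ ≅ postW (delta' G X adj Γ) (G.comp (T.comp F)) ≫
          (asc (G.comp (T.comp F)) G (T.comp F) ≫ postW (ascInv G (T.comp F) G) (T.comp F)) ≫
          postW (preWCounit G (upsilon G adj Γ)) (T.comp F) :=
        whiskerLeftIso _ (whiskerRightIso (pentagon₁ G (T.comp F) G (T.comp F)) _)
    _ ≅ (postW (delta' G X adj Γ) (G.comp (T.comp F)) ≫ asc (G.comp (T.comp F)) G (T.comp F)) ≫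
          postW (ascInv G (T.comp F) G) (T.comp F) ≫
          postW (preWCounit G (upsilon G adj Γ)) (T.comp F) := ⊗𝟙
    _ ≅ (asc (R.comp F) G (T.comp F) ≫ postW (postW (delta' G X adj Γ) G) (T.comp F)) ≫
          postW (ascInv G (T.comp F) G) (T.comp F) ≫
          postW (preWCounit G (upsilon G adj Γ)) (T.comp F) :=
        whiskerRightIso (ascFirst _ _ _) _
    _ ≅ asc (R.comp F) G (T.comp F) ≫ postW (postW (delta' G X adj Γ) G) (T.comp F) ≫
          postW (ascInv G (T.comp F) G) (T.comp F) ≫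
          postW (preWCounit G (upsilon G adj Γ)) (T.comp F) := α_ _ _ _
    _ ≅ asc (R.comp F) G (T.comp F) ≫ postW (postW (delta' G X adj Γ) G ≫
          ascInv G (T.comp F) G ≫ preWCounit G (upsilon G adj Γ)) (T.comp F) :=
        whiskerLeftIso _ (whiskerLeftIso _ (postWComp _ _ _).symm ≪≫ (postWComp _ _ _).symm)
    _ ≅ asc (R.comp F) G (T.comp F) ≫ postW (postWCounit X G) (T.comp F) :=
        whiskerLeftIso _ (postWIso (phi₂'' G X adj Γ) (T.comp F))
    _ ≅ postWCounit X (G.comp (T.comp F)) := ascCounitFirst X G (T.comp F)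

/-- The invertible modification `φ₂ : K_G ∘ Δ'' ≅ Δ' ∘ F R (X)`. -/
def phi₂ :
    delta'' G X adj Γ ≫ preW G (kappa G X adj Γ) ≅
      postWCounit X (R.comp F) ≫ delta' G X adj Γ :=
  calc
    (postW (delta' G X adj Γ) (R.comp F) ≫ ascInv G (T.comp F) (R.comp F)) ≫
        preW G (preW (T.comp F) (delta' G X adj Γ) ≫ kappa' G adj Γ)
      ≅ (postW (delta' G X adj Γ) (R.comp F) ≫ ascInv G (T.comp F) (R.comp F)) ≫
          preW G (preW (T.comp F) (delta' G X adj Γ)) ≫ preW G (kappa' G adj Γ) :=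
        whiskerLeftIso _ (preWComp G _ _)
    _ ≅ postW (delta' G X adj Γ) (R.comp F) ≫ (ascInv G (T.comp F) (R.comp F) ≫
          preW G (preW (T.comp F) (delta' G X adj Γ))) ≫ preW G (kappa' G adj Γ) := ⊗𝟙
    _ ≅ postW (delta' G X adj Γ) (R.comp F) ≫ (preW (G.comp (T.comp F)) (delta' G X adj Γ) ≫
          ascInv G (T.comp F) (G.comp (T.comp F))) ≫ preW G (kappa' G adj Γ) :=
        whiskerLeftIso _ (whiskerRightIso (ascInvLast _ _ _).symm _)
    _ ≅ (postW (delta' G X adj Γ) (R.comp F) ≫ preW (G.comp (T.comp F)) (delta' G X adj Γ)) ≫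
          ascInv G (T.comp F) (G.comp (T.comp F)) ≫ preW G (kappa' G adj Γ) := ⊗𝟙
    _ ≅ (preW (R.comp F) (delta' G X adj Γ) ≫ postW (delta' G X adj Γ) (G.comp (T.comp F))) ≫
          ascInv G (T.comp F) (G.comp (T.comp F)) ≫ preW G (kappa' G adj Γ) :=
        whiskerRightIso (exch (delta' G X adj Γ) (delta' G X adj Γ)) _
    _ ≅ preW (R.comp F) (delta' G X adj Γ) ≫ postW (delta' G X adj Γ) (G.comp (T.comp F)) ≫
          ascInv G (T.comp F) (G.comp (T.comp F)) ≫ preW G (kappa' G adj Γ) := α_ _ _ _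
    _ ≅ preW (R.comp F) (delta' G X adj Γ) ≫ postWCounit X (G.comp (T.comp F)) :=
        whiskerLeftIso _ (phi₂' G X adj Γ)
    _ ≅ postWCounit X (R.comp F) ≫ delta' G X adj Γ := exchCounitPost X (delta' G X adj Γ)

end Triangle

end Whiskering

end Bicat

open Bicat

/-! Write `Π` for the co-inverter `FT ⟶ S` (called `P` in the code), and compose in the usual order.
`S` is presented as the quotient of `FT` that makes `ξ` invertible, so the data of `G ⊣ S` can be
obtained by descent.

Counit: `Υ''` inverts `G(ξ)` and `G(Π)` is a co-inverter of `G(ξ)`, so `Υ'' ≅ κ ∘ G(Π)` for some `κ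
: GS ⟶ Id`.

Unit: `X` is a co-inverter of `π`, so it suffices that `Π_G ∘ Δ'` inverts `π`. The equation relating
`π` to `ξ` says that `Δ' * π` is `ξ_G * Δ''` up to the invertible `φ₁` and `φ₂`, and `Π_G` inverts
`ξ_G` because `Π` inverts `ξ`. This is `isIso_whiskerRight_delta'`. Hence `Π_G ∘ Δ' ≅ η ∘ X` for
some `η : Id ⟶ SG`.

Left triangle: composed with `G(X)`, the composite `κ_G ∘ G(η)` turns into `κ_G ∘ G(Π)_G ∘ G(Δ') ≅
Υ''_G ∘ G(Δ') ≅ G(X)` (`leftTriangleImage`). As `G(X)` is co-fully faithful, it can be cancelled.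

Right triangle: composed with `Π`, the composite `S(κ) ∘ η_S` turns into `S(Υ'') ∘ η_{FT}`
(`rightTriangleImage`). Composed further with `X_{FT}`, this becomes `Π ∘ K` (`unitUpsilonImage`),
which is `Π ∘ X_{FT}` through the invertible `ξ * Π`. Cancelling first the co-fully faithful
`X_{FT}` and then the co-inverter `Π` leaves the identity of `S`.

Since no swallowtail equation is demanded, any isomorphism filling each triangle will do, and no
compatibility between the chosen lifts has to be checked. -/

namespace Bicat

/-! ### Cancellation and factorization through co-fully faithful 1-morphisms and co-inverters. -/

section Cancellation

variable {D : Type uD} [Bicategory.{wD, vD} D] {x y z : D}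

theorem CoFullyFaithful.cancel {p : x ⟶ y} (hp : CoFullyFaithful p) {h h' : y ⟶ z}
    (e : p ≫ h ≅ p ≫ h') : Nonempty (h ≅ h') := by
  obtain ⟨_, _⟩ := hp z
  exact ⟨(precomp z p).preimageIso e⟩

/-- Cones form a full subcategory, so an isomorphism of the underlying 1-morphisms is already one of
cones, and the fully faithful comparison reflects it. -/
theorem IsCoinverter.cancel {f g : x ⟶ y} {φ : f ⟶ g} {p : y ⟶ z} (hp : IsCoinverter φ p)
    {w : D} {h h' : z ⟶ w} (e : p ≫ h ≅ p ≫ h') : Nonempty (h ≅ h') := by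
  have := hp.universal w
  exact ⟨(coinvComparison φ hp.cone w).preimageIso ((coinvCone φ w).isoMk e)⟩

/-- This is the essential surjectivity of the comparison. It is the only source of new 1-morphisms
in the proof: both the unit and the counit come from it. -/
theorem IsCoinverter.exists_factor {f g : x ⟶ y} {φ : f ⟶ g} {p : y ⟶ z}
    (hp : IsCoinverter φ p) {w : D} (k : y ⟶ w) (hk : IsIso (φ ▷ k)) :
    ∃ h : z ⟶ w, Nonempty (p ≫ h ≅ k) := by
  have := hp.universal w
  exact ⟨(coinvComparison φ hp.cone w).objPreimage ⟨k, hk⟩,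
    ⟨(coinvCone φ w).ι.mapIso ((coinvComparison φ hp.cone w).objObjPreimageIso ⟨k, hk⟩)⟩⟩

end Cancellation

/-! ### Further coherence and exchange laws for whiskering. -/

section Whiskering

variable {A : Type uA} [Bicategory.{wA, vA} A] {B : Type uB} [Bicategory.{wB, vB} B]
  {C : Type uC} [Bicategory.{wC, vC} C] {D : Type uD} [Bicategory.{wD, vD} D]

/-- `lunit` and `lunitInv` are quasi-inverse. -/
def lunitLunitInv (P : A ⥤ᵖ B) : lunit P ≫ lunitInv P ≅ 𝟙 ((Pseudofunctor.id A).comp P) :=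
  Pseudofunctor.StrongTrans.isoMk
    (fun a => (idE (Iso.refl _) (Iso.refl _) : 𝟙 (P.obj a) ≫ 𝟙 _ ≅ 𝟙 _) ≪≫
      (Iso.refl (𝟙 _)).symm)
    (fun _ => IdLike.nat ((IdLike.refl _).comp (IdLike.refl _)) (IdLike.refl _))

/-- `runit` and `runitInv` are quasi-inverse. -/
def runitRunitInv (P : A ⥤ᵖ B) : runit P ≫ runitInv P ≅ 𝟙 (P.comp (Pseudofunctor.id B)) :=
  Pseudofunctor.StrongTrans.isoMk
    (fun a => (idE (Iso.refl _) (Iso.refl _) : 𝟙 (P.obj a) ≫ 𝟙 _ ≅ 𝟙 _) ≪≫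
      (Iso.refl (𝟙 _)).symm)
    (fun _ => IdLike.nat ((IdLike.refl _).comp (IdLike.refl _)) (IdLike.refl _))

def runitInvNat {F₁ F₂ : A ⥤ᵖ B} (η : F₁ ⟶ F₂) :
    η ≫ runitInv F₂ ≅ runitInv F₁ ≫ postW η (Pseudofunctor.id B) :=
  -- Post-whiskering by the identity pseudofunctor pads the structure 2-cell with the identity
  -- comparison 2-cells of that pseudofunctor; this padding is the only difference between the two
  -- sides.
  Pseudofunctor.StrongTrans.isoMk (fun a => ρ_ (η.app a) ≪≫ (λ_ _).symm)
    (fun f => shift_aux (𝟙 _ ≫ (η.naturality f).hom ≫ 𝟙 _) (η.naturality f).hom (by simp))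

def ascInvMid (F : A ⥤ᵖ B) {G₁ G₂ : B ⥤ᵖ C} (θ : G₁ ⟶ G₂) (H : C ⥤ᵖ D) :
    postW (preW F θ) H ≫ ascInv F G₂ H ≅ ascInv F G₁ H ≫ preW F (postW θ H) :=
  Pseudofunctor.StrongTrans.isoMk (fun a => ρ_ (H.map (θ.app (F.obj a))) ≪≫ (λ_ _).symm)
    (fun f => shift_aux ((H.mapComp _ _).inv ≫ H.map₂ (θ.naturality (F.map f)).hom ≫
      (H.mapComp _ _).hom) _ rfl)

def ascLast (F : A ⥤ᵖ B) (G : B ⥤ᵖ C) {H₁ H₂ : C ⥤ᵖ D} (θ : H₁ ⟶ H₂) :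
    preW F (preW G θ) ≫ asc F G H₂ ≅ asc F G H₁ ≫ preW (F.comp G) θ :=
  Pseudofunctor.StrongTrans.isoMk (fun a => ρ_ (θ.app (G.obj (F.obj a))) ≪≫ (λ_ _).symm)
    (fun f => shift_aux (θ.naturality (G.map (F.map f))).hom _ rfl)

def postWCounitComp {P P' : A ⥤ᵖ A} (σ : P ⟶ P') (τ : P' ⟶ Pseudofunctor.id A)
    (G : A ⥤ᵖ B) : postWCounit (σ ≫ τ) G ≅ postW σ G ≫ postWCounit τ G :=
  whiskerRightIso (postWComp σ τ G) (lunit G) ≪≫ α_ _ _ _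

/-- At each object this is the pseudonaturality of `η` along the component of `θ`, corrected by
unitors. It carries the unit of `G ⊣ S` past the co-inverter in the right triangle. -/
def exchUnitPre {P₁ P₂ : A ⥤ᵖ B} (θ : P₁ ⟶ P₂) {G : B ⥤ᵖ B} (η : Pseudofunctor.id B ⟶ G) :
    θ ≫ preWUnit P₂ η ≅ preWUnit P₁ η ≫ postW θ G :=
  calc
    θ ≫ runitInv P₂ ≫ preW P₂ η
      ≅ (θ ≫ runitInv P₂) ≫ preW P₂ η := (α_ _ _ _).symm
    _ ≅ (runitInv P₁ ≫ postW θ (Pseudofunctor.id B)) ≫ preW P₂ η :=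
        whiskerRightIso (runitInvNat θ) _
    _ ≅ runitInv P₁ ≫ postW θ (Pseudofunctor.id B) ≫ preW P₂ η := α_ _ _ _
    _ ≅ runitInv P₁ ≫ preW P₁ η ≫ postW θ G := whiskerLeftIso _ (exch θ η)
    _ ≅ (runitInv P₁ ≫ preW P₁ η) ≫ postW θ G := (α_ _ _ _).symm

/-- The two unitors built into the whiskerings meet in the middle and cancel. This form lets the
factorization of `Δ'` followed by `Π_G` through `X` be applied under `G`. -/
def postWCounitUnit {P Q : A ⥤ᵖ A} (τ : P ⟶ Pseudofunctor.id A) (η : Pseudofunctor.id A ⟶ Q)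
    (G : A ⥤ᵖ B) : postWCounit τ G ≫ postWUnit η G ≅ postW (τ ≫ η) G :=
  calc
    (postW τ G ≫ lunit G) ≫ lunitInv G ≫ postW η G
      ≅ postW τ G ≫ (lunit G ≫ lunitInv G) ≫ postW η G := ⊗𝟙
    _ ≅ postW τ G ≫ 𝟙 _ ≫ postW η G := whiskerLeftIso _ (whiskerRightIso (lunitLunitInv G) _)
    _ ≅ postW τ G ≫ postW η G := whiskerLeftIso _ (λ_ _)
    _ ≅ postW (τ ≫ η) G := (postWComp τ η G).symm

def preWCounitUnit (G : A ⥤ᵖ B) {P Q : B ⥤ᵖ B} (τ : P ⟶ Pseudofunctor.id B)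
    (η : Pseudofunctor.id B ⟶ Q) : preWCounit G τ ≫ preWUnit G η ≅ preW G (τ ≫ η) :=
  calc
    (preW G τ ≫ runit G) ≫ runitInv G ≫ preW G η
      ≅ preW G τ ≫ (runit G ≫ runitInv G) ≫ preW G η := ⊗𝟙
    _ ≅ preW G τ ≫ 𝟙 _ ≫ preW G η := whiskerLeftIso _ (whiskerRightIso (runitRunitInv G) _)
    _ ≅ preW G τ ≫ preW G η := whiskerLeftIso _ (λ_ _)
    _ ≅ preW G (τ ≫ η) := (preWComp G τ η).symm

/-- Pre-whiskering only reindexes components, so it commutes definitionally with `▷`, and it sends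
invertible modifications to invertible ones. -/
theorem isIso_preW₂_whiskerRight (P : A ⥤ᵖ B) {G₁ G₂ G₃ : B ⥤ᵖ C} {θ θ' : G₁ ⟶ G₂}
    (m : θ ⟶ θ') (k : G₂ ⟶ G₃) (h : IsIso (m ▷ k)) : IsIso (preW₂ P m ▷ preW P k) :=
  (preWIso P (asIso (m ▷ k))).isIso_hom

end Whiskering

/-! ### Descent of the unit, and the two triangles before cancellation. -/

section AdjointTriangle

variable {A : Type uA} [Bicategory.{wA, vA} A] {B : Type uB} [Bicategory.{wB, vB} B]
  {C : Type uC} [Bicategory.{wC, vC} C]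
  {F : A ⥤ᵖ B} {R : B ⥤ᵖ A} {H : A ⥤ᵖ C} {T : C ⥤ᵖ A} {G : B ⥤ᵖ C}
  {X : R.comp F ⟶ Pseudofunctor.id B} {adj : Biadjunction H T}
  {Γ : Bicategory.Equivalence (F.comp G) H} {S : C ⥤ᵖ B} {P : T.comp F ⟶ S}

/-- This is what allows the unit to be factored through `X`. Only the cone property of `P` enters:
`P_G` need not be a co-inverter of `ξ_G`. -/
theorem isIso_whiskerRight_delta' (ξ : preWCounit (T.comp F) X ⟶ kappa G X adj Γ)
    (hP : IsIso (ξ ▷ P)) (π : preWCounit (R.comp F) X ⟶ postWCounit X (R.comp F))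
    (hπ : (delta'' G X adj Γ ◁ preW₂ G ξ) ≫ (phi₂ G X adj Γ).hom =
      (phi₁ G X adj Γ).hom ≫ (π ▷ delta' G X adj Γ)) :
    IsIso (π ▷ (delta' G X adj Γ ≫ preW G P)) := by
  have := isIso_preW₂_whiskerRight G ξ P hP
  -- The compatibility equation, solved for the whiskered `π`; it exhibits it as `ξ_G` whiskered
  -- with `Δ''`, between two invertible modifications.
  have hδ : π ▷ delta' G X adj Γ = (phi₁ G X adj Γ).inv ≫
      (delta'' G X adj Γ ◁ preW₂ G ξ) ≫ (phi₂ G X adj Γ).hom := by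
    rw [hπ, Iso.inv_hom_id_assoc]
  -- After whiskering with `P_G`, the middle factor becomes `Δ'' ◁ (ξ_G ▷ P_G)` up to associators,
  -- so every factor is invertible.
  rw [Bicategory.whiskerRight_comp, hδ, Bicategory.comp_whiskerRight,
    Bicategory.comp_whiskerRight, Bicategory.whisker_assoc]
  infer_instance

/-- The left triangle of `G ⊣ S`, pre-composed with `G(X)`. -/
def leftTriangleImage {κ : S.comp G ⟶ Pseudofunctor.id C} {η : Pseudofunctor.id B ⟶ G.comp S}
    (e : postW P G ≫ κ ≅ upsilon G adj Γ) (n : X ≫ η ≅ delta' G X adj Γ ≫ preW G P) :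
    postWCounit X G ≫ postWUnit η G ≫ ascInv G S G ≫ preWCounit G κ ≅ postWCounit X G :=
  calc
    postWCounit X G ≫ postWUnit η G ≫ ascInv G S G ≫ preWCounit G κ
      ≅ (postWCounit X G ≫ postWUnit η G) ≫ ascInv G S G ≫ preWCounit G κ := (α_ _ _ _).symm
    _ ≅ (postW (delta' G X adj Γ) G ≫ postW (preW G P) G) ≫ ascInv G S G ≫ preWCounit G κ :=
        whiskerRightIso (postWCounitUnit X η G ≪≫ postWIso n G ≪≫ postWComp _ _ _) _
    _ ≅ postW (delta' G X adj Γ) G ≫ (postW (preW G P) G ≫ ascInv G S G) ≫ preWCounit G κ :=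
        ⊗𝟙
    _ ≅ postW (delta' G X adj Γ) G ≫ (ascInv G (T.comp F) G ≫ preW G (postW P G)) ≫
          preWCounit G κ := whiskerLeftIso _ (whiskerRightIso (ascInvMid G P G) _)
    _ ≅ postW (delta' G X adj Γ) G ≫ ascInv G (T.comp F) G ≫ preW G (postW P G) ≫
          preWCounit G κ := whiskerLeftIso _ (α_ _ _ _)
    -- The defining isomorphism of `κ`, pre-whiskered by `G`, removes `S` and leaves only data of
    -- the original biadjunctions.
    _ ≅ postW (delta' G X adj Γ) G ≫ ascInv G (T.comp F) G ≫ preWCounit G (upsilon G adj Γ) :=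
        whiskerLeftIso _ (whiskerLeftIso _ ((preWCounitComp G _ _).symm ≪≫
          whiskerRightIso (preWIso G e) (runit G)))
    -- Here the left triangle of `H ⊣ T`, transported along `Γ`, enters.
    _ ≅ postWCounit X G := phi₂'' G X adj Γ

/-- The composite `S(Υ'') ∘ η_{F T}`, pre-composed with `X_{F T}`. -/
def unitUpsilonImage {η : Pseudofunctor.id B ⟶ G.comp S}
    (n : X ≫ η ≅ delta' G X adj Γ ≫ preW G P) :
    preWCounit (T.comp F) X ≫ preWUnit (T.comp F) η ≫ asc (T.comp F) G S ≫
      postWCounit (upsilon G adj Γ) S ≅ kappa G X adj Γ ≫ P :=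
  calc
    preWCounit (T.comp F) X ≫ preWUnit (T.comp F) η ≫ asc (T.comp F) G S ≫
        postWCounit (upsilon G adj Γ) S
      ≅ (preWCounit (T.comp F) X ≫ preWUnit (T.comp F) η) ≫ asc (T.comp F) G S ≫
          postWCounit (upsilon G adj Γ) S := (α_ _ _ _).symm
    _ ≅ (preW (T.comp F) (delta' G X adj Γ) ≫ preW (T.comp F) (preW G P)) ≫
          asc (T.comp F) G S ≫ postWCounit (upsilon G adj Γ) S :=
        whiskerRightIso (preWCounitUnit (T.comp F) X η ≪≫ preWIso (T.comp F) n ≪≫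
          preWComp _ _ _) _
    _ ≅ preW (T.comp F) (delta' G X adj Γ) ≫ (preW (T.comp F) (preW G P) ≫
          asc (T.comp F) G S) ≫ postWCounit (upsilon G adj Γ) S := ⊗𝟙
    _ ≅ preW (T.comp F) (delta' G X adj Γ) ≫ (asc (T.comp F) G (T.comp F) ≫
          preW ((T.comp F).comp G) P) ≫ postWCounit (upsilon G adj Γ) S :=
        whiskerLeftIso _ (whiskerRightIso (ascLast (T.comp F) G P) _)
    _ ≅ preW (T.comp F) (delta' G X adj Γ) ≫ asc (T.comp F) G (T.comp F) ≫
          preW ((T.comp F).comp G) P ≫ postWCounit (upsilon G adj Γ) S :=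
        whiskerLeftIso _ (α_ _ _ _)
    _ ≅ preW (T.comp F) (delta' G X adj Γ) ≫ asc (T.comp F) G (T.comp F) ≫
          postWCounit (upsilon G adj Γ) (T.comp F) ≫ P :=
        whiskerLeftIso _ (whiskerLeftIso _ (exchCounitPost (upsilon G adj Γ) P))
    _ ≅ (preW (T.comp F) (delta' G X adj Γ) ≫ asc (T.comp F) G (T.comp F) ≫
          postWCounit (upsilon G adj Γ) (T.comp F)) ≫ P := ⊗𝟙

/-- The right triangle of `G ⊣ S`, pre-composed with the co-inverter `F T ⟶ S`. -/
def rightTriangleImage {κ : S.comp G ⟶ Pseudofunctor.id C} (η : Pseudofunctor.id B ⟶ G.comp S)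
    (e : postW P G ≫ κ ≅ upsilon G adj Γ) :
    P ≫ preWUnit S η ≫ asc S G S ≫ postWCounit κ S ≅
      preWUnit (T.comp F) η ≫ asc (T.comp F) G S ≫ postWCounit (upsilon G adj Γ) S :=
  calc
    P ≫ preWUnit S η ≫ asc S G S ≫ postWCounit κ S
      ≅ (P ≫ preWUnit S η) ≫ asc S G S ≫ postWCounit κ S := (α_ _ _ _).symm
    _ ≅ (preWUnit (T.comp F) η ≫ postW P (G.comp S)) ≫ asc S G S ≫ postWCounit κ S :=
        whiskerRightIso (exchUnitPre P η) _
    _ ≅ preWUnit (T.comp F) η ≫ (postW P (G.comp S) ≫ asc S G S) ≫ postWCounit κ S := ⊗𝟙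
    _ ≅ preWUnit (T.comp F) η ≫ (asc (T.comp F) G S ≫ postW (postW P G) S) ≫
          postWCounit κ S := whiskerLeftIso _ (whiskerRightIso (ascFirst P G S) _)
    _ ≅ preWUnit (T.comp F) η ≫ asc (T.comp F) G S ≫ postW (postW P G) S ≫
          postWCounit κ S := whiskerLeftIso _ (α_ _ _ _)
    _ ≅ preWUnit (T.comp F) η ≫ asc (T.comp F) G S ≫ postWCounit (upsilon G adj Γ) S :=
        whiskerLeftIso _ (whiskerLeftIso _ ((postWCounitComp _ κ S).symm ≪≫
          whiskerRightIso (postWIso e S) (lunit S)))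

end AdjointTriangle

end Bicat

/-! ### Assembly of the biadjunction. -/

theorem mainTheorem5
    {A : Type uA} [Bicategory.{wA, vA} A] {B : Type uB} [Bicategory.{wB, vB} B]
    {C : Type uC} [Bicategory.{wC, vC} C]
    (F : A ⥤ᵖ B) (R : B ⥤ᵖ A) (H : A ⥤ᵖ C) (T : C ⥤ᵖ A) (G : B ⥤ᵖ C)
    (adjF : Biadjunction F R) (adjH : Biadjunction H T)
    (Γ : Bicategory.Equivalence (F.comp G) H)
    (ξ : preWCounit (T.comp F) adjF.counit ⟶ kappa G adjF.counit adjH Γ)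
    (S : C ⥤ᵖ B) (P : T.comp F ⟶ S)
    (hP : IsCoinverter ξ P)
    (hGP : IsCoinverter (postW₂ ξ G) (postW P G))
    (hυ : IsIso (postW₂ ξ G ▷ upsilon G adjH Γ))
    (hπ : ∃ π : preWCounit (R.comp F) adjF.counit ⟶ postWCounit adjF.counit (R.comp F),
      IsCoinverter π adjF.counit ∧
      (delta'' G adjF.counit adjH Γ ◁ preW₂ G ξ) ≫ (phi₂ G adjF.counit adjH Γ).hom =
        (phi₁ G adjF.counit adjH Γ).hom ≫ (π ▷ delta' G adjF.counit adjH Γ))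
    (hGX : CoFullyFaithful (postWCounit adjF.counit G))
    (hXFT : CoFullyFaithful (preWCounit (T.comp F) adjF.counit)) :
    Nonempty (Biadjunction G S) := by
  obtain ⟨π, hπX, hπ⟩ := hπ
  have hξP : IsIso (ξ ▷ P) := hP.cone
  -- The counit: `Υ''` descends along `G(Π)`.
  obtain ⟨κ, ⟨e⟩⟩ := hGP.exists_factor (upsilon G adjH Γ) hυ
  -- The unit: `Π_G ∘ Δ'` descends along `X`.
  obtain ⟨η, ⟨n⟩⟩ := hπX.exists_factor (delta' G adjF.counit adjH Γ ≫ preW G P)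
    (isIso_whiskerRight_delta' ξ hξP π hπ)
  obtain ⟨l⟩ := hGX.cancel (leftTriangleImage e n ≪≫ (ρ_ _).symm)
  -- The inverse of `ξ * Π` turns `Π ∘ K` back into `Π ∘ X_{FT}`, so that `X_{FT}` appears on both
  -- sides; the result is `S(Υ'') ∘ η_{FT} ≅ Π`.
  obtain ⟨u⟩ := hXFT.cancel (unitUpsilonImage n ≪≫ (asIso (ξ ▷ P)).symm)
  -- Only here is the universal property of `Π` itself used, and only through full faithfulness.
  obtain ⟨r⟩ := hP.cancel (rightTriangleImage η e ≪≫ u ≪≫ (ρ_ P).symm)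
  exact ⟨⟨η, κ, l, r⟩⟩
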